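/- Let $\lambda\in\mathbb N$ be the security parameter. "Polynomial time" is non-uniform: classical algorithms are polynomial-size Boolean circuits with uniform random bits, and QPT algorithms are polynomial-size families of general quantum circuits (gates, fresh qubits $|0\rangle$, discarding of qubits). **Ingredients.** * $\mathsf{UE}=(\mathsf{Setup},\mathsf{Enc},\mathsf{Dec})$: a (one-time) uncloneable encryption scheme, that is, QPT algorithms with classical keys $k_{UE}$, classical messages in $\{0,1\}^{n}$, $n=n(\lambda)$ polynomially bounded, and quantum ciphertexts, such that decryption of an honest ciphertext is correct up to a negligible error. * $\mathsf{SKE}=(\mathsf{Setup},\mathsf{Enc},\mathsf{Dec})$: a classical polynomial-time symmetric-key encryption scheme for messages of length $|k_{UE}|$, with deterministic $\mathsf{Dec}$, correct up to a negligible error, and with post-quantum pseudorandom ciphertexts: for all messages $x_\lambda$, an encryption of $x_\lambda$ under a fresh key cannot be distinguished by QPT algorithms, with non-negligible advantage, from a uniform string of the same length. * $\mathsf{FE}=(\mathsf{Setup},\mathsf{KeyGen},\mathsf{Enc},\mathsf{Dec})$: a classical polynomial-time public-key functional encryption scheme for Boolean circuits with $1+|k_{SKE}|+|k_{UE}|$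 input bits and $|k_{UE}|$ output bits, correct up to a negligible error ($\mathsf{Dec}(\mathsf{SK}_C,\mathsf{Enc}(\mathsf{mpk},x))=C(x)$), and post-quantum single-key secure in the following sense. In the real experiment a stateful QPT adversary chooses a circuit size $s$ (polynomially bounded), receives $\mathsf{mpk}$ from $(\mathsf{mpk},\mathsf{MSK})\leftarrow\mathsf{Setup}(1^\lambda,1^s)$, outputs a message $x$, receives $\mathsf{Enc}(\mathsf{mpk},x)$, outputs a circuit $C$ of size $s$, receives $\mathsf{KeyGen}(\mathsf{MSK},C)$, and outputs a bit. In the simulated experiment a stateful QPT simulator produces $\mathsf{mpk}$ from $(1^\lambda,1^s)$, then the ciphertext from $1^{|x|}$ only, then the functional key from $(C,C(x))$. Security: for every adversary there is a simulator such that the probabilities of the output $0$ in the two experiments differ by a negligible function of $\lambda$. **The scheme $\mathsf{PBKUE}$.** For a string $ct$ of the length of an $\mathsf{SKE}$ ciphertext let $F[ct]$ be the circuit with $F[ct](b,K,m)=\mathsf{SKE}.\mathsf{Dec}(K,ct)$ if $b=0$ and $F[ct](b,K,m)=m$ if $b=1$. * $\mathsf{Setup}(1^\lambda)$: run $(\mathsf{mpk},\mathsf{MSK})\leftarrow\mathsf{FE}.\mathsf{Setup}(1^\lambda,1^s)$,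 where $s$ is the size of the circuits $F[ct]$; sample $ct$ uniformly at random; compute $\mathsf{FE}.sk\leftarrow\mathsf{FE}.\mathsf{KeyGen}(\mathsf{MSK},F[ct])$. The public key is $pk=\mathsf{mpk}$ and the secret key is $k=\mathsf{FE}.sk$. * $\mathsf{Enc}(pk,m)$: sample $k_{UE}\leftarrow\mathsf{UE}.\mathsf{Setup}(1^\lambda)$ and output $(ct_1,ct_2)$ with $ct_1\leftarrow\mathsf{FE}.\mathsf{Enc}(pk,(1,\bot,k_{UE}))$ and $ct_2\leftarrow\mathsf{UE}.\mathsf{Enc}(k_{UE},m)$, where $\bot$ is encoded as the zero string. * $\mathsf{Dec}(k,(ct_1,ct_2))$: compute $k^*=\mathsf{FE}.\mathsf{Dec}(k,ct_1)$ and output $\mathsf{UE}.\mathsf{Dec}(k^*,ct_2)$. **Uncloneable security.** In the cloning experiment a message $m\in\{0,1\}^n$ is sampled uniformly and encrypted under freshly generated keys. Alice receives the ciphertext (and, for a public-key scheme, the public key) and outputs a bipartite state, one part for Bob and one part for Charlie. Bob and Charlie then each receive the decryption key and, without communicating, output $m_B$ and $m_C$. They win if $m_B=m_C=m$. For $t=t(\lambda)\in\mathbb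 R$, a scheme is $t$-uncloneable secure if for every QPT adversary (Alice, Bob, Charlie) there is a negligible function $\varepsilon$ such that the winning probability is at most $2^{-n+t}+\varepsilon(\lambda)$ for all $\lambda$. **Theorem.** For every such $\mathsf{UE}$, $\mathsf{SKE}$, $\mathsf{FE}$ and every function $t:\mathbb N\to\mathbb R$: if $\mathsf{UE}$ is $t$-uncloneable secure, then $\mathsf{PBKUE}$ is $t$-uncloneable secure. -/

import Mathlib

open Filter

noncomputable section

/-! ### Bits, averages, asymptotics -/

/-- Bit strings whose positions are indexed by `α`. -/
abbrev Bits (α : Type) : Type := α → Bool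

/-- Expectation of `f` over a uniformly random bit string. -/
def avg {α : Type} [Fintype α] [DecidableEq α] (f : Bits α → ℝ) : ℝ :=
  (∑ x, f x) / 2 ^ Fintype.card α

/-- Negligible functions of the security parameter. -/
def Negligible (f : ℕ → ℝ) : Prop :=
  Asymptotics.SuperpolynomialDecay atTop (fun n : ℕ => (n : ℝ)) f

/-- Bounded by a polynomial in the security parameter. -/
def PolyBounded (f : ℕ → ℕ) : Prop :=
  ∃ p : Polynomial ℕ, ∀ n, f n ≤ p.eval n

/-! ### Boolean circuits -/

/-- Boolean circuits with input wires `ι`, `s` internal gates and output wires `o`, given by their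
wiring tables. Every internal gate and every output gate is a NAND of a set of wires; the table says
which input wires and which internal gates feed which gate. An internal gate reads only the
internal gates that precede it. The table is itself a bit string, so that a circuit can be given as
an input to an algorithm. -/
abbrev BCirc (ι : Type) (s : ℕ) (o : Type) : Type := Bits ((Fin s ⊕ o) × (ι ⊕ Fin s))

open Classical in
/-- The negation of the truth value of `P`. -/
def nand (P : Prop) : Bool := decide (¬ P)

/-- The value of the internal gate `k` on the input `x`. -/
def BCirc.gate {ι o : Type} {s : ℕ} (C : BCirc ι s o) (x : Bits ι) (k : Fin s) : Bool :=
  nand ((∀ i, C (.inl k, .inl i) = true → x i = true) ∧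
    ∀ j : {j : Fin s // j < k}, C (.inl k, .inr j.1) = true → BCirc.gate C x j.1 = true)
termination_by k.val
decreasing_by exact j.2

/-- The function computed by a Boolean circuit. -/
def BCirc.eval {ι o : Type} {s : ℕ} (C : BCirc ι s o) (x : Bits ι) : Bits o := fun y =>
  nand ((∀ i, C (.inr y, .inl i) = true → x i = true) ∧
    ∀ j : Fin s, C (.inr y, .inr j) = true → C.gate x j = true)

/-- A family of functions, indexed by `J`, is computed by Boolean circuits of size polynomial in
`w j`, where `w j` is the length of the unary parameters of the instance `j`. -/
def PolyComputable {J : Type} (w : J → ℕ) {ι o : J → Type}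
    [∀ j, Fintype (ι j)] [∀ j, Fintype (o j)] (f : ∀ j, Bits (ι j) → Bits (o j)) : Prop :=
  ∃ p : Polynomial ℕ, ∀ j,
    Fintype.card (ι j) ≤ p.eval (w j) ∧ Fintype.card (o j) ≤ p.eval (w j) ∧
    ∃ s ≤ p.eval (w j), ∃ C : BCirc (ι j) s (o j), ∀ x, C.eval x = f j x

/-! ### Quantum circuits -/

/-- General (mixed-state) quantum circuits with input qubits `α` and output qubits `β`:
gates X, H, T, CNOT, Toffoli, fresh qubits in the state `|0⟩`, and discarding of qubits. -/
inductive QCirc : Type → Type → Type 1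
  | wire {α β : Type} (e : α ≃ β) : QCirc α β
  | seq {α β γ : Type} [Fintype β] [DecidableEq β] (c : QCirc α β) (d : QCirc β γ) : QCirc α γ
  | par {α β γ δ : Type} (c : QCirc α β) (d : QCirc γ δ) : QCirc (α ⊕ γ) (β ⊕ δ)
  | x : QCirc Unit Unit
  | h : QCirc Unit Unit
  | t : QCirc Unit Unit
  | cnot : QCirc (Unit ⊕ Unit) (Unit ⊕ Unit)
  | toffoli : QCirc (Unit ⊕ Unit ⊕ Unit) (Unit ⊕ Unit ⊕ Unit)
  | init : QCirc Empty Unit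
  | discard : QCirc Unit Empty

/-- The number of gates. -/
def QCirc.size : {α β : Type} → QCirc α β → ℕ
  | _, _, .wire _ => 0
  | _, _, @QCirc.seq _ _ _ _ _ c d => c.size + d.size
  | _, _, .par c d => c.size + d.size
  | _, _, .x => 1
  | _, _, .h => 1
  | _, _, .t => 1
  | _, _, .cnot => 1
  | _, _, .toffoli => 1
  | _, _, .init => 1
  | _, _, .discard => 1

open Classical in
/-- The matrix of the classical reversible gate `f`. -/
def permGate {α : Type} (f : Bits α → Bits α) : Matrix (Bits α) (Bits α) ℂ :=
  Matrix.of fun y x => if y = f x then 1 else 0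

/-- The Hadamard gate. -/
def hadamard : Matrix (Bits Unit) (Bits Unit) ℂ :=
  Matrix.of fun y x => (if x () && y () then -1 else 1) / (Real.sqrt 2 : ℂ)

open Classical in
/-- The T gate `diag(1, exp(iπ/4))`. -/
def tGate : Matrix (Bits Unit) (Bits Unit) ℂ :=
  Matrix.of fun y x =>
    if y = x then (if x () then Complex.exp (Complex.I * (Real.pi / 4 : ℝ)) else 1) else 0

/-- The superoperator `ρ ↦ U ρ U†`; the entry at `y`, `x` is the coefficient of
`|y.1⟩⟨y.2|` in the image of `|x.1⟩⟨x.2|`. -/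
def conjBy {α : Type} (U : Matrix (Bits α) (Bits α) ℂ) (y x : Bits α × Bits α) : ℂ :=
  U y.1 x.1 * star (U y.2 x.2)

open Classical in
/-- The quantum channel of a circuit: `c.eval y x` is the coefficient of `|y.1⟩⟨y.2|` in the image
of `|x.1⟩⟨x.2|`. -/
def QCirc.eval : {α β : Type} → QCirc α β → Bits β × Bits β → Bits α × Bits α → ℂ
  | _, _, .wire e => fun y x => if y.1 ∘ e = x.1 ∧ y.2 ∘ e = x.2 then 1 else 0
  | _, _, @QCirc.seq _ _ _ _ _ c d => fun z x => ∑ y₁, ∑ y₂, d.eval z (y₁, y₂) * c.eval (y₁, y₂) x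
  | _, _, .par c d => fun y x =>
      c.eval (y.1 ∘ .inl, y.2 ∘ .inl) (x.1 ∘ .inl, x.2 ∘ .inl) *
        d.eval (y.1 ∘ .inr, y.2 ∘ .inr) (x.1 ∘ .inr, x.2 ∘ .inr)
  | _, _, .x => conjBy (permGate fun b _ => !b ())
  | _, _, .h => conjBy hadamard
  | _, _, .t => conjBy tGate
  | _, _, .cnot => conjBy (permGate fun b =>
      Sum.elim (fun _ => b (.inl ())) (fun _ => xor (b (.inr ())) (b (.inl ()))))
  | _, _, .toffoli => conjBy (permGate fun b =>
      Sum.elim (fun _ => b (.inl ())) (Sum.elim (fun _ => b (.inr (.inl ())))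
        (fun _ => xor (b (.inr (.inr ()))) (b (.inl ()) && b (.inr (.inl ()))))))
  | _, _, .init => fun y _ => if y.1 () = false ∧ y.2 () = false then 1 else 0
  | _, _, .discard => fun _ x => if x.1 = x.2 then 1 else 0

/-- Quantum polynomial time (non-uniform): a family of circuits of polynomial size. -/
def QPT {α β : ℕ → Type} (c : ∀ n, QCirc (α n) (β n)) : Prop :=
  PolyBounded fun n => (c n).size

/-- Operators on the qubits `α`. -/
abbrev Op (α : Type) : Type := Matrix (Bits α) (Bits α) ℂ

/-- The circuit applied to the state `ρ`. -/
def QCirc.apply {α β : Type} [Fintype α] [DecidableEq α] (c : QCirc α β) (ρ : Op α) : Op β :=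
  Matrix.of fun y y' => ∑ a, ∑ a', c.eval (y, y') (a, a') * ρ a a'

/-- The circuit applied to `|x⟩⟨x| ⊗ ρ`, for a classical string `x`. -/
def QCirc.applyWith {ι α β : Type} [Fintype α] [DecidableEq α] (c : QCirc (ι ⊕ α) β)
    (x : Bits ι) (ρ : Op α) : Op β :=
  Matrix.of fun y y' =>
    ∑ a, ∑ a', c.eval (y, y') (Sum.elim x a, Sum.elim x a') * ρ a a'

/-- One move of an interactive quantum machine: on the classical message `x` and the memory `ρ` it
runs `c` and measures the message part of the output. The result is the new memory for the
outcome `y`, with trace equal to the probability of `y`. -/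
def QCirc.step {ι o α β : Type} [Fintype α] [DecidableEq α] (c : QCirc (ι ⊕ α) (o ⊕ β))
    (x : Bits ι) (y : Bits o) (ρ : Op α) : Op β :=
  Matrix.of fun i j => c.applyWith x ρ (Sum.elim y i) (Sum.elim y j)

/-- The probability that a circuit run on the classical input `x` gives `y` when all its output
qubits are measured. -/
def QCirc.prob {α β : Type} (c : QCirc α β) (x : Bits α) (y : Bits β) : ℝ :=
  (c.eval (y, y) (x, x)).re

/-! ### Uncloneable encryption (one-time, private-key) -/

/-- An uncloneable encryption scheme with classical keys, classical messages of length `msgLen`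
and quantum ciphertexts of `ctLen` qubits. -/
structure UEScheme where
  msgLen : ℕ → ℕ
  keyLen : ℕ → ℕ
  ctLen : ℕ → ℕ
  setup : ∀ n, QCirc Empty (Fin (keyLen n))
  enc : ∀ n, QCirc (Fin (keyLen n) ⊕ Fin (msgLen n)) (Fin (ctLen n))
  dec : ∀ n, QCirc (Fin (keyLen n) ⊕ Fin (ctLen n)) (Fin (msgLen n))
  msgLen_poly : PolyBounded msgLen
  setup_qpt : QPT setup
  enc_qpt : QPT enc
  dec_qpt : QPT dec

namespace UEScheme

/-- The probability that `Setup` outputs the key `k`. -/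
def keyProb (UE : UEScheme) (n : ℕ) (k : Bits (Fin (UE.keyLen n))) : ℝ :=
  (UE.setup n).prob Empty.elim k

/-- The ciphertext state of the message `m` under the key `k`. -/
def encState (UE : UEScheme) (n : ℕ) (k : Bits (Fin (UE.keyLen n)))
    (m : Bits (Fin (UE.msgLen n))) : Op (Fin (UE.ctLen n)) :=
  Matrix.of fun i j => (UE.enc n).eval (i, j) (Sum.elim k m, Sum.elim k m)

/-- Decryption of an honest ciphertext succeeds up to a negligible error. -/
def Correct (UE : UEScheme) : Prop :=
  ∃ ε : ℕ → ℝ, Negligible ε ∧ ∀ n m, 1 - ε n ≤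
    ∑ k, UE.keyProb n k * ((UE.dec n).applyWith k (UE.encState n k m) m m).re

end UEScheme

/-- The probability that Bob and Charlie, sharing the state `σ` and each given `key`, both
output `m`. -/
def bothGuess {κ μ β γ : Type} [Fintype β] [DecidableEq β] [Fintype γ] [DecidableEq γ]
    (B : QCirc (κ ⊕ β) μ) (C : QCirc (κ ⊕ γ) μ) (key : Bits κ) (m : Bits μ)
    (σ : Op (β ⊕ γ)) : ℝ :=
  (∑ i, ∑ i', ∑ j, ∑ j', B.eval (m, m) (Sum.elim key i, Sum.elim key i') *
    C.eval (m, m) (Sum.elim key j, Sum.elim key j') * σ (Sum.elim i j) (Sum.elim i' j')).re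

/-- A cloning adversary. Alice maps her input register to the two registers of Bob
and Charlie, who guess the message from their registers and the decryption key. -/
structure CloningAdversary (input key msg : ℕ → Type) where
  memB : ℕ → ℕ
  memC : ℕ → ℕ
  alice : ∀ n, QCirc (input n) (Fin (memB n) ⊕ Fin (memC n))
  bob : ∀ n, QCirc (key n ⊕ Fin (memB n)) (msg n)
  charlie : ∀ n, QCirc (key n ⊕ Fin (memC n)) (msg n)
  alice_qpt : QPT alice
  bob_qpt : QPT bob
  charlie_qpt : QPT charlie

namespace UEScheme

/-- Cloning adversaries against a private-key scheme: Alice gets the ciphertext. -/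
abbrev Adversary (UE : UEScheme) :=
  CloningAdversary (fun n => Fin (UE.ctLen n)) (fun n => Fin (UE.keyLen n))
    (fun n => Fin (UE.msgLen n))

/-- The winning probability in the cloning experiment. -/
def winProb (UE : UEScheme) (𝒜 : UE.Adversary) (n : ℕ) : ℝ :=
  ∑ k, UE.keyProb n k * avg fun m =>
    bothGuess (𝒜.bob n) (𝒜.charlie n) k m ((𝒜.alice n).apply (UE.encState n k m))

/-- `t`-uncloneable security. -/
def UncloneableSecure (UE : UEScheme) (t : ℕ → ℝ) : Prop :=
  ∀ 𝒜 : UE.Adversary, ∃ ε : ℕ → ℝ, Negligible ε ∧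
    ∀ n, UE.winProb 𝒜 n ≤ (2 : ℝ) ^ (-(UE.msgLen n : ℝ) + t n) + ε n

end UEScheme

/-! ### Public-key uncloneable encryption -/

/-- A public-key uncloneable encryption scheme. `setup` turns uniform coins into a pair of a public
key and a secret key, `enc` gives the ciphertext state, and `dec sk ρ m` is the probability that
decrypting `ρ` with `sk` gives `m`. -/
structure PKUEScheme where
  msgLen : ℕ → ℕ
  Coins : ℕ → Type
  Pk : ℕ → Type
  Sk : ℕ → Type
  Ct : ℕ → Type
  [coinsFintype : ∀ n, Fintype (Coins n)]
  [coinsDecEq : ∀ n, DecidableEq (Coins n)]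
  [ctFintype : ∀ n, Fintype (Ct n)]
  [ctDecEq : ∀ n, DecidableEq (Ct n)]
  setup : ∀ n, Bits (Coins n) → Bits (Pk n) × Bits (Sk n)
  enc : ∀ n, Bits (Pk n) → Bits (Fin (msgLen n)) → Op (Ct n)
  dec : ∀ n, Bits (Sk n) → Op (Ct n) → Bits (Fin (msgLen n)) → ℝ

attribute [instance] PKUEScheme.coinsFintype PKUEScheme.coinsDecEq
attribute [instance] PKUEScheme.ctFintype PKUEScheme.ctDecEq

namespace PKUEScheme

/-- Cloning adversaries against a public-key scheme: Alice gets the public key and the ciphertext,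
Bob and Charlie get the secret key. -/
abbrev Adversary (S : PKUEScheme) :=
  CloningAdversary (fun n => S.Pk n ⊕ S.Ct n) S.Sk (fun n => Fin (S.msgLen n))

/-- The winning probability in the cloning experiment. -/
def winProb (S : PKUEScheme) (𝒜 : S.Adversary) (n : ℕ) : ℝ :=
  avg fun r : Bits (S.Coins n) => avg fun m : Bits (Fin (S.msgLen n)) =>
    bothGuess (𝒜.bob n) (𝒜.charlie n) (S.setup n r).2 m
      ((𝒜.alice n).applyWith (S.setup n r).1 (S.enc n (S.setup n r).1 m))

/-- `t`-uncloneable security. -/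
def UncloneableSecure (S : PKUEScheme) (t : ℕ → ℝ) : Prop :=
  ∀ 𝒜 : S.Adversary, ∃ ε : ℕ → ℝ, Negligible ε ∧
    ∀ n, S.winProb 𝒜 n ≤ (2 : ℝ) ^ (-(S.msgLen n : ℝ) + t n) + ε n

end PKUEScheme

/-! ### Symmetric-key encryption with pseudorandom ciphertexts -/

/-- A classical symmetric-key encryption scheme for messages of length `msgLen`. `Setup` and `Enc`
take their coins as an argument; `Dec` is given as a Boolean circuit. -/
structure SKEScheme (msgLen : ℕ → ℕ) where
  keyLen : ℕ → ℕ
  ctLen : ℕ → ℕ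
  setupCoins : ℕ → ℕ
  encCoins : ℕ → ℕ
  decGates : ℕ → ℕ
  setup : ∀ n, Bits (Fin (setupCoins n)) → Bits (Fin (keyLen n))
  enc : ∀ n, Bits (Fin (keyLen n) ⊕ Fin (msgLen n) ⊕ Fin (encCoins n)) → Bits (Fin (ctLen n))
  dec : ∀ n, BCirc (Fin (keyLen n) ⊕ Fin (ctLen n)) (decGates n) (Fin (msgLen n))
  setup_poly : PolyComputable (fun n : ℕ => n) setup
  enc_poly : PolyComputable (fun n : ℕ => n) enc
  dec_poly : PolyBounded decGates

namespace SKEScheme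

variable {msgLen : ℕ → ℕ}

/-- Expectation of `f` over a fresh key and a fresh ciphertext of `x`. -/
def expect (S : SKEScheme msgLen) (n : ℕ) (x : Bits (Fin (msgLen n)))
    (f : Bits (Fin (S.keyLen n)) → Bits (Fin (S.ctLen n)) → ℝ) : ℝ :=
  avg fun r => avg fun r' =>
    f (S.setup n r) (S.enc n (Sum.elim (S.setup n r) (Sum.elim x r')))

open Classical in
/-- Decryption succeeds up to a negligible error. -/
def Correct (S : SKEScheme msgLen) : Prop :=
  ∃ ε : ℕ → ℝ, Negligible ε ∧ ∀ n x, 1 - ε n ≤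
    S.expect n x fun k c => if (S.dec n).eval (Sum.elim k c) = x then 1 else 0

/-- Post-quantum pseudorandom ciphertexts: a ciphertext of any message under a fresh key is
computationally indistinguishable from a uniform string. -/
def PseudorandomCiphertexts (S : SKEScheme msgLen) : Prop :=
  ∀ (x : ∀ n, Bits (Fin (msgLen n))) (D : ∀ n, QCirc (Fin (S.ctLen n)) Unit), QPT D →
    Negligible fun n =>
      |S.expect n (x n) (fun _ c => (D n).prob c fun _ => true) -
        avg fun c => (D n).prob c fun _ => true|

end SKEScheme

/-! ### Single-key public-key functional encryption -/

/-- A classical public-key functional encryption scheme for the Boolean circuits with input wires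
`In n` and output wires `Out n`, where `n` is the security parameter. The algorithms depend on
`n` and on the circuit size `s`, and run in time polynomial in `n + s`. -/
structure FEScheme (In Out : ℕ → Type) [∀ n, Fintype (In n)] [∀ n, Fintype (Out n)] where
  mpkLen : ℕ → ℕ → ℕ
  mskLen : ℕ → ℕ → ℕ
  skLen : ℕ → ℕ → ℕ
  ctLen : ℕ → ℕ → ℕ
  setupCoins : ℕ → ℕ → ℕ
  keyGenCoins : ℕ → ℕ → ℕ
  encCoins : ℕ → ℕ → ℕ
  setup : ∀ n s, Bits (Fin (setupCoins n s)) → Bits (Fin (mpkLen n s) ⊕ Fin (mskLen n s))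
  keyGen : ∀ n s, Bits (Fin (mskLen n s) ⊕ ((Fin s ⊕ Out n) × (In n ⊕ Fin s)) ⊕
    Fin (keyGenCoins n s)) → Bits (Fin (skLen n s))
  enc : ∀ n s, Bits (Fin (mpkLen n s) ⊕ In n ⊕ Fin (encCoins n s)) → Bits (Fin (ctLen n s))
  dec : ∀ n s, Bits (Fin (skLen n s) ⊕ Fin (ctLen n s)) → Bits (Out n)
  setup_poly : PolyComputable (fun j : ℕ × ℕ => j.1 + j.2) fun j => setup j.1 j.2
  keyGen_poly : PolyComputable (fun j : ℕ × ℕ => j.1 + j.2) fun j => keyGen j.1 j.2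
  enc_poly : PolyComputable (fun j : ℕ × ℕ => j.1 + j.2) fun j => enc j.1 j.2
  dec_poly : PolyComputable (fun j : ℕ × ℕ => j.1 + j.2) fun j => dec j.1 j.2

namespace FEScheme

variable {In Out : ℕ → Type} [∀ n, Fintype (In n)] [∀ n, Fintype (Out n)]

/-- The master public key. -/
def mpk (FE : FEScheme In Out) (n s : ℕ) (r : Bits (Fin (FE.setupCoins n s))) :
    Bits (Fin (FE.mpkLen n s)) := fun i => FE.setup n s r (.inl i)

/-- The master secret key. -/
def msk (FE : FEScheme In Out) (n s : ℕ) (r : Bits (Fin (FE.setupCoins n s))) :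
    Bits (Fin (FE.mskLen n s)) := fun i => FE.setup n s r (.inr i)

/-- The functional key of the circuit `C`. -/
def funKey (FE : FEScheme In Out) (n s : ℕ) (msk : Bits (Fin (FE.mskLen n s)))
    (C : BCirc (In n) s (Out n)) (r : Bits (Fin (FE.keyGenCoins n s))) :
    Bits (Fin (FE.skLen n s)) := FE.keyGen n s (Sum.elim msk (Sum.elim C r))

/-- The ciphertext of `x`. -/
def encrypt (FE : FEScheme In Out) (n s : ℕ) (mpk : Bits (Fin (FE.mpkLen n s)))
    (x : Bits (In n)) (r : Bits (Fin (FE.encCoins n s))) :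
    Bits (Fin (FE.ctLen n s)) := FE.enc n s (Sum.elim mpk (Sum.elim x r))

open Classical in
/-- Decrypting with a functional key gives the value of the circuit, up to a negligible error. -/
def Correct (FE : FEScheme In Out) : Prop :=
  ∀ s : ℕ → ℕ, PolyBounded s → ∃ ε : ℕ → ℝ, Negligible ε ∧
    ∀ n (C : BCirc (In n) (s n) (Out n)) (x : Bits (In n)), 1 - ε n ≤
      avg fun r => avg fun r₁ => avg fun r₂ =>
        if FE.dec n (s n) (Sum.elim (FE.funKey n (s n) (FE.msk n (s n) r) C r₁)
            (FE.encrypt n (s n) (FE.mpk n (s n) r) x r₂)) = C.eval x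
        then 1 else 0

/-- An adversary in the single-key experiment. It fixes the circuit size; on the
master public key it outputs the challenge message; on the challenge ciphertext it outputs the
queried circuit; on the functional key it outputs a bit. It keeps a quantum memory. -/
structure Adversary (FE : FEScheme In Out) where
  circSize : ℕ → ℕ
  mem₁ : ℕ → ℕ
  mem₂ : ℕ → ℕ
  chooseMsg : ∀ n, QCirc (Fin (FE.mpkLen n (circSize n)) ⊕ Empty) (In n ⊕ Fin (mem₁ n))
  chooseCirc : ∀ n, QCirc (Fin (FE.ctLen n (circSize n)) ⊕ Fin (mem₁ n))
    (((Fin (circSize n) ⊕ Out n) × (In n ⊕ Fin (circSize n))) ⊕ Fin (mem₂ n))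
  guess : ∀ n, QCirc (Fin (FE.skLen n (circSize n)) ⊕ Fin (mem₂ n)) (Unit ⊕ Empty)
  circSize_poly : PolyBounded circSize
  chooseMsg_qpt : QPT chooseMsg
  chooseCirc_qpt : QPT chooseCirc
  guess_qpt : QPT guess

/-- A simulator in the single-key experiment. It outputs a master public key; then a ciphertext,
from the length of the challenge message only; then a functional key, from the queried circuit and
its value on the challenge message. It keeps a quantum memory. -/
structure Simulator (FE : FEScheme In Out) (s : ℕ → ℕ) where
  mem₁ : ℕ → ℕ
  mem₂ : ℕ → ℕ
  simMpk : ∀ n, QCirc (Empty ⊕ Empty) (Fin (FE.mpkLen n (s n)) ⊕ Fin (mem₁ n))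
  simCt : ∀ n, QCirc (Empty ⊕ Fin (mem₁ n)) (Fin (FE.ctLen n (s n)) ⊕ Fin (mem₂ n))
  simKey : ∀ n, QCirc ((((Fin (s n) ⊕ Out n) × (In n ⊕ Fin (s n))) ⊕ Out n) ⊕ Fin (mem₂ n))
    (Fin (FE.skLen n (s n)) ⊕ Empty)
  simMpk_qpt : QPT simMpk
  simCt_qpt : QPT simCt
  simKey_qpt : QPT simKey

/-- The probability that the adversary sends `x`, then `C`, then outputs `0`, when it
receives `mpk`, then `ct`, then `sk`. -/
def Adversary.prob {FE : FEScheme In Out} (A : FE.Adversary) (n : ℕ)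
    (mpk : Bits (Fin (FE.mpkLen n (A.circSize n)))) (x : Bits (In n))
    (ct : Bits (Fin (FE.ctLen n (A.circSize n)))) (C : BCirc (In n) (A.circSize n) (Out n))
    (sk : Bits (Fin (FE.skLen n (A.circSize n)))) : ℝ :=
  (((A.guess n).step sk (fun _ => false) ((A.chooseCirc n).step ct C
    ((A.chooseMsg n).step mpk x 1))).trace).re

/-- The probability that the simulator sends `mpk`, then `ct`, then `sk`, when it
receives the circuit `C` and the value `y` before the last message. -/
def Simulator.prob {FE : FEScheme In Out} {s : ℕ → ℕ} (S : FE.Simulator s) (n : ℕ)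
    (mpk : Bits (Fin (FE.mpkLen n (s n)))) (ct : Bits (Fin (FE.ctLen n (s n))))
    (C : BCirc (In n) (s n) (Out n)) (y : Bits (Out n))
    (sk : Bits (Fin (FE.skLen n (s n)))) : ℝ :=
  (((S.simKey n).step (Sum.elim C y) sk ((S.simCt n).step Empty.elim ct
    ((S.simMpk n).step Empty.elim mpk 1))).trace).re

variable [∀ n, DecidableEq (In n)] [∀ n, DecidableEq (Out n)]

/-- The probability that the real experiment outputs `0`. -/
def realProb (FE : FEScheme In Out) (A : FE.Adversary) (n : ℕ) : ℝ :=
  avg fun r => ∑ x : Bits (In n), avg fun r₁ =>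
    ∑ C : BCirc (In n) (A.circSize n) (Out n), avg fun r₂ =>
      A.prob n (FE.mpk n _ r) x (FE.encrypt n _ (FE.mpk n _ r) x r₁) C
        (FE.funKey n _ (FE.msk n _ r) C r₂)

/-- The probability that the simulated experiment outputs `0`. -/
def simProb (FE : FEScheme In Out) (A : FE.Adversary) (S : FE.Simulator A.circSize)
    (n : ℕ) : ℝ :=
  ∑ mpk, ∑ x : Bits (In n), ∑ ct, ∑ C : BCirc (In n) (A.circSize n) (Out n), ∑ sk,
    S.prob n mpk ct C (C.eval x) sk * A.prob n mpk x ct C sk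

/-- Post-quantum single-key security. -/
def Secure (FE : FEScheme In Out) : Prop :=
  ∀ A : FE.Adversary, ∃ S : FE.Simulator A.circSize,
    Negligible fun n => |FE.realProb A n - FE.simProb A S n|

end FEScheme

/-! ### The circuit `F[ct]` -/

/-- Input wires of `F[ct]`: the flag `b`, a symmetric key `K` and a string `m`. -/
abbrev TrojanIn (κ u : ℕ) : Type := Unit ⊕ Fin κ ⊕ Fin u

/-- Internal gates of `F[ct]`: the constant 0, the negated flag, the hardwired bits of `ct`, the
gates and the outputs of the decryption circuit, and the two halves of the final selection. -/
inductive TrojanGate (c d u : ℕ) : Type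
  | zero
  | notFlag
  | ctBit (i : Fin c)
  | decGate (k : Fin d)
  | decOut (j : Fin u)
  | sel₀ (j : Fin u)
  | sel₁ (j : Fin u)

/-- The number of internal gates of `F[ct]`. -/
abbrev trojanSize (c d u : ℕ) : ℕ := 2 + c + d + 3 * u

/-- The position of a gate of `F[ct]`. -/
def TrojanGate.pos {c d u : ℕ} : TrojanGate c d u → Fin (trojanSize c d u)
  | zero => ⟨0, by unfold trojanSize; omega⟩
  | notFlag => ⟨1, by unfold trojanSize; omega⟩
  | ctBit i => ⟨2 + i, by unfold trojanSize; omega⟩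
  | decGate k => ⟨2 + c + k, by unfold trojanSize; omega⟩
  | decOut j => ⟨2 + c + d + j, by unfold trojanSize; omega⟩
  | sel₀ j => ⟨2 + c + d + u + j, by unfold trojanSize; omega⟩
  | sel₁ j => ⟨2 + c + d + 2 * u + j, by unfold trojanSize; omega⟩

/-- The wiring of `F[ct]`: which input wires and gates feed which gates (NAND) and outputs. -/
inductive TrojanWire {κ c d u : ℕ} (D : BCirc (Fin κ ⊕ Fin c) d (Fin u)) (ct : Bits (Fin c)) :
    TrojanGate c d u ⊕ Fin u → TrojanIn κ u ⊕ TrojanGate c d u → Prop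
  | notFlag : TrojanWire D ct (.inl .notFlag) (.inl (.inl ()))
  | ctBit (i : Fin c) : ct i = true → TrojanWire D ct (.inl (.ctBit i)) (.inr .zero)
  | gateKey (k : Fin d) (i : Fin κ) : D (.inl k, .inl (.inl i)) = true →
      TrojanWire D ct (.inl (.decGate k)) (.inl (.inr (.inl i)))
  | gateCt (k : Fin d) (i : Fin c) : D (.inl k, .inl (.inr i)) = true →
      TrojanWire D ct (.inl (.decGate k)) (.inr (.ctBit i))
  | gateGate (k j : Fin d) : D (.inl k, .inr j) = true →
      TrojanWire D ct (.inl (.decGate k)) (.inr (.decGate j))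
  | outKey (k : Fin u) (i : Fin κ) : D (.inr k, .inl (.inl i)) = true →
      TrojanWire D ct (.inl (.decOut k)) (.inl (.inr (.inl i)))
  | outCt (k : Fin u) (i : Fin c) : D (.inr k, .inl (.inr i)) = true →
      TrojanWire D ct (.inl (.decOut k)) (.inr (.ctBit i))
  | outGate (k : Fin u) (j : Fin d) : D (.inr k, .inr j) = true →
      TrojanWire D ct (.inl (.decOut k)) (.inr (.decGate j))
  | sel₀Flag (j : Fin u) : TrojanWire D ct (.inl (.sel₀ j)) (.inr .notFlag)
  | sel₀Dec (j : Fin u) : TrojanWire D ct (.inl (.sel₀ j)) (.inr (.decOut j))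
  | sel₁Flag (j : Fin u) : TrojanWire D ct (.inl (.sel₁ j)) (.inl (.inl ()))
  | sel₁Msg (j : Fin u) : TrojanWire D ct (.inl (.sel₁ j)) (.inl (.inr (.inr j)))
  | out₀ (j : Fin u) : TrojanWire D ct (.inr j) (.inr (.sel₀ j))
  | out₁ (j : Fin u) : TrojanWire D ct (.inr j) (.inr (.sel₁ j))

open Classical in
/-- The Boolean circuit `F[ct]`, built from the decryption circuit `D`: on input `(b, K, m)`
it outputs `D(K, ct)` if `b = 0` and `m` otherwise. -/
def trojan {κ c d u : ℕ} (D : BCirc (Fin κ ⊕ Fin c) d (Fin u)) (ct : Bits (Fin c)) :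
    BCirc (TrojanIn κ u) (trojanSize c d u) (Fin u) := fun p =>
  decide (∃ a b, TrojanWire D ct a b ∧ a.map TrojanGate.pos id = p.1 ∧
    b.map id TrojanGate.pos = p.2)

theorem nand_eq_true {P : Prop} : nand P = true ↔ ¬ P := by simp [nand]

theorem TrojanGate.pos_injective {c d u : ℕ} :
    Function.Injective (TrojanGate.pos : TrojanGate c d u → _) := by
  intro a b h
  have h' := congrArg Fin.val h
  cases a <;> cases b <;> simp only [TrojanGate.pos] at h' <;>
    first
      | rfl
      | (exfalso; omega)
      | (congr 1; apply Fin.ext; omega)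

theorem trojan_apply {κ c d u : ℕ} (D : BCirc (Fin κ ⊕ Fin c) d (Fin u)) (ct : Bits (Fin c))
    (a : TrojanGate c d u ⊕ Fin u) (b : TrojanIn κ u ⊕ TrojanGate c d u) :
    trojan D ct (a.map TrojanGate.pos id, b.map id TrojanGate.pos) = true ↔ TrojanWire D ct a b := by
  unfold trojan
  simp only [decide_eq_true_iff]
  constructor
  · rintro ⟨a', b', h, h1, h2⟩
    have e1 := (Sum.map_injective.2 ⟨TrojanGate.pos_injective, Function.injective_id⟩) h1
    have e2 := (Sum.map_injective.2 ⟨Function.injective_id, TrojanGate.pos_injective⟩) h2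
    subst e1; subst e2; exact h
  · intro h; exact ⟨a, b, h, rfl, rfl⟩

theorem TrojanGate.pos_surjective {c d u : ℕ} :
    Function.Surjective (TrojanGate.pos : TrojanGate c d u → _) := by
  rintro ⟨k, hk⟩
  unfold trojanSize at hk
  by_cases h0 : k = 0
  · exact ⟨.zero, Fin.ext h0.symm⟩
  by_cases h1 : k = 1
  · exact ⟨.notFlag, Fin.ext h1.symm⟩
  by_cases h2 : k < 2 + c
  · exact ⟨.ctBit ⟨k - 2, by omega⟩, Fin.ext (by simp only [TrojanGate.pos]; omega)⟩
  by_cases h3 : k < 2 + c + d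
  · exact ⟨.decGate ⟨k - (2 + c), by omega⟩, Fin.ext (by simp only [TrojanGate.pos]; omega)⟩
  by_cases h4 : k < 2 + c + d + u
  · exact ⟨.decOut ⟨k - (2 + c + d), by omega⟩, Fin.ext (by simp only [TrojanGate.pos]; omega)⟩
  by_cases h5 : k < 2 + c + d + 2 * u
  · exact ⟨.sel₀ ⟨k - (2 + c + d + u), by omega⟩, Fin.ext (by simp only [TrojanGate.pos]; omega)⟩
  · exact ⟨.sel₁ ⟨k - (2 + c + d + 2 * u), by omega⟩, Fin.ext (by simp only [TrojanGate.pos]; omega)⟩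

theorem trojan_gate {κ c d u : ℕ} (D : BCirc (Fin κ ⊕ Fin c) d (Fin u)) (ct : Bits (Fin c))
    (x : Bits (TrojanIn κ u)) (g : TrojanGate c d u) :
    (trojan D ct).gate x g.pos = true ↔
      ¬ ((∀ i, TrojanWire D ct (.inl g) (.inl i) → x i = true) ∧
        ∀ g', TrojanWire D ct (.inl g) (.inr g') → g'.pos < g.pos →
          (trojan D ct).gate x g'.pos = true) := by
  rw [BCirc.gate, nand_eq_true]
  apply not_congr
  apply and_congr
  · exact forall_congr' fun i => imp_congr (trojan_apply D ct (.inl g) (.inl i)) Iff.rfl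
  · constructor
    · intro h g' hw hlt
      exact h ⟨g'.pos, hlt⟩ ((trojan_apply D ct (.inl g) (.inr g')).2 hw)
    · rintro h ⟨j, hj⟩ hC
      obtain ⟨g', rfl⟩ := TrojanGate.pos_surjective j
      exact h g' ((trojan_apply D ct (.inl g) (.inr g')).1 hC) hj

/-- The circuit `trojan D ct` computes `F[ct]`. -/
theorem trojan_eval {κ c d u : ℕ} (D : BCirc (Fin κ ⊕ Fin c) d (Fin u)) (ct : Bits (Fin c))
    (b : Bool) (K : Bits (Fin κ)) (m : Bits (Fin u)) :
    (trojan D ct).eval (Sum.elim (fun _ => b) (Sum.elim K m)) =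
      if b = false then D.eval (Sum.elim K ct) else m := by
  set x : Bits (TrojanIn κ u) := Sum.elim (fun _ => b) (Sum.elim K m) with hx
  have hzero : (trojan D ct).gate x (TrojanGate.zero).pos = false := by
    rw [← Bool.not_eq_true, trojan_gate, not_not]
    exact ⟨fun i h => (nomatch h), fun g h => (nomatch h)⟩
  have hnot : (trojan D ct).gate x (TrojanGate.notFlag).pos = !b := by
    rw [Bool.eq_iff_iff, trojan_gate]
    constructor
    · intro h
      cases b
      · rfl
      · exact absurd ⟨fun i h => by cases h; rfl, fun g h => (nomatch h)⟩ h
    · rintro h ⟨h1, -⟩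
      have := h1 _ .notFlag
      simp_all
  have hct (i) : (trojan D ct).gate x (TrojanGate.ctBit i).pos = ct i := by
    rw [Bool.eq_iff_iff, trojan_gate]
    constructor
    · intro h
      by_contra hi
      exact h ⟨fun i h => (nomatch h), fun g h => by cases h; contradiction⟩
    · rintro h ⟨-, h2⟩
      have := h2 _ (.ctBit i h) (by simp [TrojanGate.pos, Fin.lt_def])
      simp_all
  have hdec (k : Fin d) : (trojan D ct).gate x (TrojanGate.decGate k).pos =
      D.gate (Sum.elim K ct) k := by
    induction k using WellFoundedLT.induction with
    | ind k ih =>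
    rw [Bool.eq_iff_iff, trojan_gate, BCirc.gate, nand_eq_true]
    apply not_congr
    constructor
    · rintro ⟨h1, h2⟩
      refine ⟨?_, ?_⟩
      · rintro (i | i) hi
        · exact h1 _ (.gateKey k i hi)
        · have := h2 _ (.gateCt k i hi) (by simp only [TrojanGate.pos, Fin.lt_def]; omega)
          rwa [hct] at this
      · rintro ⟨j, hj⟩ hC
        have := h2 _ (.gateGate k j hC) (by simp only [TrojanGate.pos, Fin.lt_def] at *; omega)
        rwa [ih j hj] at this
    · rintro ⟨h1, h2⟩
      refine ⟨fun i h => ?_, fun g h hlt => ?_⟩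
      · cases h with
        | gateKey _ i hi => exact h1 _ hi
      · cases h with
        | gateCt _ i hi => rw [hct]; exact h1 _ hi
        | gateGate _ j hj =>
          have hlt' : j < k := by simp only [TrojanGate.pos, Fin.lt_def] at *; omega
          rw [ih j hlt']
          exact h2 ⟨j, hlt'⟩ hj
  have hout (k : Fin u) : (trojan D ct).gate x (TrojanGate.decOut k).pos =
      D.eval (Sum.elim K ct) k := by
    rw [Bool.eq_iff_iff, trojan_gate, BCirc.eval, nand_eq_true]
    apply not_congr
    constructor
    · rintro ⟨h1, h2⟩
      refine ⟨?_, ?_⟩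
      · rintro (i | i) hi
        · exact h1 _ (.outKey k i hi)
        · have := h2 _ (.outCt k i hi) (by simp only [TrojanGate.pos, Fin.lt_def]; omega)
          rwa [hct] at this
      · intro j hC
        have := h2 _ (.outGate k j hC) (by simp only [TrojanGate.pos, Fin.lt_def] at *; omega)
        rwa [hdec j] at this
    · rintro ⟨h1, h2⟩
      refine ⟨fun i h => ?_, fun g h hlt => ?_⟩
      · cases h with
        | outKey _ i hi => exact h1 _ hi
      · cases h with
        | outCt _ i hi => rw [hct]; exact h1 _ hi
        | outGate _ j hj => rw [hdec j]; exact h2 j hj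
  have hs0 (j : Fin u) : (trojan D ct).gate x (TrojanGate.sel₀ j).pos =
      !(!b && D.eval (Sum.elim K ct) j) := by
    rw [Bool.eq_iff_iff, trojan_gate]
    constructor
    · intro h
      by_contra hc
      simp only [Bool.not_eq_true', Bool.not_eq_false, Bool.and_eq_true] at hc
      refine h ⟨fun i h => (nomatch h), fun g h hlt => ?_⟩
      cases h with
      | sel₀Flag => rw [hnot]; simpa using hc.1
      | sel₀Dec => rw [hout]; exact hc.2
    · rintro h ⟨-, h2⟩
      have e1 := h2 _ (.sel₀Flag j) (by simp only [TrojanGate.pos, Fin.lt_def]; omega)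
      have e2 := h2 _ (.sel₀Dec j) (by simp only [TrojanGate.pos, Fin.lt_def]; omega)
      rw [hnot] at e1; rw [hout] at e2
      simp_all
  have hs1 (j : Fin u) : (trojan D ct).gate x (TrojanGate.sel₁ j).pos = !(b && m j) := by
    rw [Bool.eq_iff_iff, trojan_gate]
    constructor
    · intro h
      by_contra hc
      simp only [Bool.not_eq_true', Bool.not_eq_false, Bool.and_eq_true] at hc
      refine h ⟨fun i h => ?_, fun g h => (nomatch h)⟩
      cases h with
      | sel₁Flag => exact hc.1
      | sel₁Msg => exact hc.2
    · rintro h ⟨h1, -⟩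
      have e1 := h1 _ (.sel₁Flag j)
      have e2 := h1 _ (.sel₁Msg j)
      simp_all
  funext j
  rw [Bool.eq_iff_iff, BCirc.eval, nand_eq_true]
  have key : ((∀ i, trojan D ct (.inr j, .inl i) = true → x i = true) ∧
      ∀ k, trojan D ct (.inr j, .inr k) = true → (trojan D ct).gate x k = true) ↔
      ((trojan D ct).gate x (TrojanGate.sel₀ j).pos = true ∧
        (trojan D ct).gate x (TrojanGate.sel₁ j).pos = true) := by
    constructor
    · rintro ⟨-, h⟩
      exact ⟨h _ ((trojan_apply D ct (.inr j) (.inr (.sel₀ j))).2 (.out₀ j)),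
        h _ ((trojan_apply D ct (.inr j) (.inr (.sel₁ j))).2 (.out₁ j))⟩
    · rintro ⟨h1, h2⟩
      refine ⟨fun i hi => ?_, fun k hk => ?_⟩
      · exact nomatch (trojan_apply D ct (.inr j) (.inl i)).1 hi
      · obtain ⟨g, rfl⟩ := TrojanGate.pos_surjective k
        cases (trojan_apply D ct (.inr j) (.inr g)).1 hk with
        | out₀ => exact h1
        | out₁ => exact h2
  rw [key, hs0, hs1]
  cases b <;> simp

/-! ### The public-key scheme -/

/-- The number of gates of the circuits `F[ct]` of the public-key scheme. -/
abbrev pbkueSize (UE : UEScheme) (SKE : SKEScheme UE.keyLen) (n : ℕ) : ℕ :=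
  trojanSize (SKE.ctLen n) (SKE.decGates n) (UE.keyLen n)

/-- The scheme PBKUE.
Setup: run `FE.Setup`, sample a uniform string `ct`, output the master public key and the
functional key of `F[ct]`.
Encryption: sample a key `k` of UE, output an FE encryption of `(1, ⊥, k)` together with the UE
encryption of the message under `k`; `⊥` is the zero string.
Decryption: measure the FE ciphertext, decrypt it to a key of UE, and decrypt with that key. -/
def PBKUE (UE : UEScheme) (SKE : SKEScheme UE.keyLen)
    (FE : FEScheme (fun n => TrojanIn (SKE.keyLen n) (UE.keyLen n))
      (fun n => Fin (UE.keyLen n))) : PKUEScheme where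
  msgLen := UE.msgLen
  Coins n := Fin (FE.setupCoins n (pbkueSize UE SKE n)) ⊕ Fin (SKE.ctLen n) ⊕
    Fin (FE.keyGenCoins n (pbkueSize UE SKE n))
  Pk n := Fin (FE.mpkLen n (pbkueSize UE SKE n))
  Sk n := Fin (FE.skLen n (pbkueSize UE SKE n))
  Ct n := Fin (FE.ctLen n (pbkueSize UE SKE n)) ⊕ Fin (UE.ctLen n)
  setup n r :=
    (FE.mpk n (pbkueSize UE SKE n) (r ∘ .inl),
      FE.funKey n (pbkueSize UE SKE n) (FE.msk n (pbkueSize UE SKE n) (r ∘ .inl))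
        (trojan (SKE.dec n) (r ∘ .inr ∘ .inl)) (r ∘ .inr ∘ .inr))
  enc n pk m := Matrix.of fun y y' =>
    ∑ k, (UE.keyProb n k *
      avg fun r =>
        if y ∘ .inl = FE.encrypt n (pbkueSize UE SKE n) pk
              (Sum.elim (fun _ => true) (Sum.elim (fun _ => false) k)) r ∧
            y' ∘ .inl = FE.encrypt n (pbkueSize UE SKE n) pk
              (Sum.elim (fun _ => true) (Sum.elim (fun _ => false) k)) r
        then 1 else 0 : ℝ) * UE.encState n k m (y ∘ .inr) (y' ∘ .inr)
  dec n sk ρ m :=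
    (∑ ct₁, (UE.dec n).applyWith (FE.dec n (pbkueSize UE SKE n) (Sum.elim sk ct₁))
      (Matrix.of fun i j => ρ (Sum.elim ct₁ i) (Sum.elim ct₁ j)) m m).re

end

noncomputable section

/-! ### Polynomial bounds -/

/-! The proof is a hybrid argument on the cloning experiment of the public-key scheme. The string
`ct` wired into the functional key plays no role for honest ciphertexts, whose flag is 1, so it can
serve as a trapdoor.

Hybrid 1 replaces the uniform `ct` by an `SKE` encryption of the key `k` of `UE` under a fresh key
`K`; pseudorandomness makes the change negligible (`exists_pseudorandom_bound`). Hybrid 2 replaces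
the `FE` plaintext `(1, ⊥, k)` by `(0, K, ⊥)`. Whenever `ct` decrypts to `k`, the circuit `F[ct]`
has the value `k` on both plaintexts, so single-key security applies; decryption failures cost the
correctness error of `SKE` (`negligible_switch`, `exists_switch_bound`). In hybrid 2 Alice's
classical data are independent of `k`, and the functional key is a function of `k` that Bob and
Charlie can evaluate once they hold `k`. This is a cloning attack on `UE` with the same winning
probability (`exists_ueAdversary`, `exists_hidden_bound`).

In `FE` security the simulator depends on the adversary, so separate adversaries for the two
plaintexts would have unrelated simulators. Instead a single adversary flips a coin, sends one of
the two plaintexts, and outputs 0 exactly when the coin agrees with the success of the cloners. Its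
simulator sees only the circuit and the common value, hence nothing of the coin, and the simulated
probability is exactly 1/2. The real one is 1/2 plus half the gap between the two hybrids.

Non-uniformity is used throughout: for each security parameter the worst values of the remaining
keys, messages and coins are hardwired, which makes every error bound uniform in them. Fixed coins
also let Bob and Charlie compute the same functional key without communicating.

The rest is circuit engineering: circuits are trace-preserving and completely positive, Boolean
circuits can be run by quantum circuits with polynomial overhead, and size bounds must not depend on
the hardwired data. -/

theorem PolyBounded.mono {f g : ℕ → ℕ} (hg : PolyBounded g) (h : ∀ n, f n ≤ g n) :
    PolyBounded f := by
  obtain ⟨p, hp⟩ := hg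
  exact ⟨p, fun n => (h n).trans (hp n)⟩

theorem PolyBounded.const (a : ℕ) : PolyBounded fun _ => a :=
  ⟨Polynomial.C a, fun n => by simp⟩

theorem PolyBounded.id : PolyBounded fun n => n :=
  ⟨Polynomial.X, fun n => by simp⟩

theorem PolyBounded.add {f g : ℕ → ℕ} (hf : PolyBounded f) (hg : PolyBounded g) :
    PolyBounded fun n => f n + g n := by
  obtain ⟨p, hp⟩ := hf
  obtain ⟨q, hq⟩ := hg
  exact ⟨p + q, fun n => by rw [Polynomial.eval_add]; exact add_le_add (hp n) (hq n)⟩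

theorem PolyBounded.mul {f g : ℕ → ℕ} (hf : PolyBounded f) (hg : PolyBounded g) :
    PolyBounded fun n => f n * g n := by
  obtain ⟨p, hp⟩ := hf
  obtain ⟨q, hq⟩ := hg
  exact ⟨p * q, fun n => by rw [Polynomial.eval_mul]; exact Nat.mul_le_mul (hp n) (hq n)⟩

theorem Polynomial.eval_le_eval_nat (p : Polynomial ℕ) {a b : ℕ} (h : a ≤ b) :
    p.eval a ≤ p.eval b := by
  rw [Polynomial.eval_eq_sum, Polynomial.eval_eq_sum]
  refine Finset.sum_le_sum fun n _ => ?_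
  dsimp only
  gcongr

theorem PolyBounded.polynomial_eval {f : ℕ → ℕ} (hf : PolyBounded f) (p : Polynomial ℕ) :
    PolyBounded fun n => p.eval (f n) := by
  obtain ⟨q, hq⟩ := hf
  exact ⟨p.comp q, fun n => by
    rw [Polynomial.eval_comp]; exact Polynomial.eval_le_eval_nat p (hq n)⟩

/-! ### Negligible functions -/

theorem Negligible.add {f g : ℕ → ℝ} (hf : Negligible f) (hg : Negligible g) :
    Negligible fun n => f n + g n :=
  Asymptotics.SuperpolynomialDecay.add hf hg

theorem Negligible.const_mul {f : ℕ → ℝ} (hf : Negligible f) (c : ℝ) :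
    Negligible fun n => c * f n :=
  Asymptotics.SuperpolynomialDecay.const_mul hf c

theorem Negligible.of_abs_le {f g : ℕ → ℝ} (hg : Negligible g) (h : ∀ n, |f n| ≤ g n) :
    Negligible f := by
  refine Asymptotics.SuperpolynomialDecay.trans_eventually_abs_le hg ?_
  exact Eventually.of_forall fun n => (h n).trans (le_abs_self _)

/-! ### Averages -/

section Avg

variable {α β : Type} [Fintype α] [DecidableEq α] [Fintype β] [DecidableEq β]

theorem card_bits : (Fintype.card (Bits α) : ℝ) = 2 ^ Fintype.card α := by
  simp [Bits]

theorem avg_const (c : ℝ) : avg (fun _ : Bits α => c) = c := by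
  unfold avg
  rw [Finset.sum_const, Finset.card_univ, nsmul_eq_mul, card_bits]
  field_simp

theorem avg_mono {f g : Bits α → ℝ} (h : ∀ x, f x ≤ g x) : avg f ≤ avg g := by
  unfold avg
  gcongr
  exact h _

theorem avg_sub (f g : Bits α → ℝ) : (avg fun x => f x - g x) = avg f - avg g := by
  unfold avg
  rw [Finset.sum_sub_distrib, sub_div]

theorem avg_add (f g : Bits α → ℝ) : (avg fun x => f x + g x) = avg f + avg g := by
  unfold avg
  rw [Finset.sum_add_distrib, add_div]

theorem avg_const_mul (c : ℝ) (f : Bits α → ℝ) : (avg fun x => c * f x) = c * avg f := by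
  unfold avg
  rw [← Finset.mul_sum, mul_div_assoc]

theorem avg_sum {ι : Type} (s : Finset ι) (f : ι → Bits α → ℝ) :
    (avg fun x => ∑ i ∈ s, f i x) = ∑ i ∈ s, avg (f i) := by
  unfold avg
  rw [Finset.sum_comm, Finset.sum_div]

theorem avg_comm (f : Bits α → Bits β → ℝ) :
    (avg fun x => avg fun y => f x y) = avg fun y => avg fun x => f x y := by
  unfold avg
  simp_rw [div_eq_mul_inv, ← Finset.sum_mul]
  rw [Finset.sum_comm]
  ring

theorem avg_sumElim (f : Bits (α ⊕ β) → ℝ) :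
    avg f = avg fun x => avg fun y => f (Sum.elim x y) := by
  unfold avg
  rw [← (Equiv.sumArrowEquivProdArrow α β Bool).symm.sum_comp, Fintype.sum_prod_type]
  simp_rw [← Finset.sum_div, div_div, Fintype.card_sum, pow_add]
  rw [mul_comm]
  rfl

end Avg

/-! ### Quantum circuits are quantum channels -/

section Bits

variable {α β : Type}

theorem elim_inl_inr (x : Bits (α ⊕ β)) : Sum.elim (x ∘ Sum.inl) (x ∘ Sum.inr) = x :=
  Sum.elim_comp_inl_inr x

theorem bits_sum_ext {x y : Bits (α ⊕ β)} (h₁ : x ∘ Sum.inl = y ∘ Sum.inl)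
    (h₂ : x ∘ Sum.inr = y ∘ Sum.inr) : x = y := by
  rw [← elim_inl_inr x, ← elim_inl_inr y, h₁, h₂]

theorem bits_sum_ext_iff {x y : Bits (α ⊕ β)} :
    x = y ↔ x ∘ Sum.inl = y ∘ Sum.inl ∧ x ∘ Sum.inr = y ∘ Sum.inr :=
  ⟨by rintro rfl; exact ⟨rfl, rfl⟩, fun h => bits_sum_ext h.1 h.2⟩

theorem sum_bits_sum {M : Type} [AddCommMonoid M] [Fintype (Bits (α ⊕ β))] [Fintype (Bits α)]
    [Fintype (Bits β)] (f : Bits (α ⊕ β) → M) :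
    ∑ z, f z = ∑ x : Bits α, ∑ y : Bits β, f (Sum.elim x y) := by
  rw [← Fintype.sum_prod_type' (f := fun x y => f (Sum.elim x y)),
    ← (Equiv.sumArrowEquivProdArrow α β Bool).symm.sum_comp]
  rfl

theorem sum_bits_equiv {M : Type} [AddCommMonoid M] [Fintype (Bits α)] [Fintype (Bits β)]
    (e : α ≃ β) (f : Bits β → M) : ∑ y, f y = ∑ x : Bits α, f (x ∘ e.symm) := by
  rw [← (Equiv.arrowCongr e (Equiv.refl Bool)).sum_comp]
  rfl

theorem sum_bits_unit {M : Type} [AddCommMonoid M] [Fintype (Bits Unit)] (f : Bits Unit → M) :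
    ∑ z, f z = f (fun _ => true) + f (fun _ => false) := by
  rw [← (Equiv.funUnique Unit Bool).symm.sum_comp, Fintype.sum_bool]
  rfl

theorem bits_unit_eq_iff {x y : Bits Unit} : x = y ↔ x () = y () :=
  ⟨fun h => h ▸ rfl, fun h => funext fun _ => h⟩

end Bits

namespace QCirc

variable {α β γ δ : Type}

open Classical in
theorem eval_wire (e : α ≃ β) (y : Bits β × Bits β) (x : Bits α × Bits α) :
    (wire e).eval y x = if y.1 ∘ e = x.1 ∧ y.2 ∘ e = x.2 then 1 else 0 := rfl

theorem eval_seq [Fintype β] [DecidableEq β] (c : QCirc α β) (d : QCirc β γ)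
    (z : Bits γ × Bits γ) (x : Bits α × Bits α) :
    (seq c d).eval z x = ∑ y₁, ∑ y₂, d.eval z (y₁, y₂) * c.eval (y₁, y₂) x := by
  simp only [QCirc.eval]

theorem eval_par (c : QCirc α β) (d : QCirc γ δ) (y : Bits (β ⊕ δ) × Bits (β ⊕ δ))
    (x : Bits (α ⊕ γ) × Bits (α ⊕ γ)) :
    (par c d).eval y x =
      c.eval (y.1 ∘ .inl, y.2 ∘ .inl) (x.1 ∘ .inl, x.2 ∘ .inl) *
        d.eval (y.1 ∘ .inr, y.2 ∘ .inr) (x.1 ∘ .inr, x.2 ∘ .inr) := rfl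

/-- Every circuit has a Kraus decomposition. -/
theorem exists_kraus (c : QCirc α β) :
    ∃ (ι : Type) (_ : Fintype ι) (K : ι → Bits β → Bits α → ℂ),
      ∀ y x, c.eval y x = ∑ i, K i y.1 x.1 * star (K i y.2 x.2) := by
  classical
  have unitary {α : Type} (U : Matrix (Bits α) (Bits α) ℂ) :
      ∃ (ι : Type) (_ : Fintype ι) (K : ι → Bits α → Bits α → ℂ),
        ∀ y x, conjBy U y x = ∑ i, K i y.1 x.1 * star (K i y.2 x.2) :=
    ⟨Unit, inferInstance, fun _ => U, fun y x => by simp [conjBy]⟩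
  induction c with
  | wire e =>
    refine ⟨Unit, inferInstance, fun _ y x => if y ∘ e = x then 1 else 0, fun y x => ?_⟩
    rw [eval_wire]
    by_cases h₁ : y.1 ∘ e = x.1 <;> by_cases h₂ : y.2 ∘ e = x.2 <;> simp [h₁, h₂]
  | @seq α β γ _ _ c d hc hd =>
    obtain ⟨ι, _, K, hK⟩ := hc
    obtain ⟨κ, _, L, hL⟩ := hd
    -- The Kraus operators of a composite are the products of those of its two factors.
    refine ⟨ι × κ, inferInstance, fun p z x => ∑ y, L p.2 z y * K p.1 y x, fun z x => ?_⟩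
    rw [eval_seq]
    simp_rw [hK, hL, Fintype.sum_prod_type, star_sum, Finset.sum_mul_sum, star_mul']
    calc _ = ∑ y₁, ∑ y₂, ∑ i, ∑ j, L j z.1 y₁ * K i y₁ x.1 *
          (star (L j z.2 y₂) * star (K i y₂ x.2)) := by
          refine Finset.sum_congr rfl fun y₁ _ => Finset.sum_congr rfl fun y₂ _ => ?_
          rw [Finset.sum_comm]
          refine Finset.sum_congr rfl fun i _ => Finset.sum_congr rfl fun j _ => ?_
          ring
      _ = ∑ y₁, ∑ i, ∑ y₂, ∑ j, L j z.1 y₁ * K i y₁ x.1 *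
          (star (L j z.2 y₂) * star (K i y₂ x.2)) :=
          Finset.sum_congr rfl fun y₁ _ => Finset.sum_comm
      _ = ∑ i, ∑ y₁, ∑ j, ∑ y₂, L j z.1 y₁ * K i y₁ x.1 *
          (star (L j z.2 y₂) * star (K i y₂ x.2)) := by
          rw [Finset.sum_comm]
          exact Finset.sum_congr rfl fun i _ => Finset.sum_congr rfl fun y₁ _ => Finset.sum_comm
      _ = _ := Finset.sum_congr rfl fun i _ => Finset.sum_comm
  | par c d hc hd =>
    obtain ⟨ι, _, K, hK⟩ := hc
    obtain ⟨κ, _, L, hL⟩ := hd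
    refine ⟨ι × κ, inferInstance,
      fun p y x => K p.1 (y ∘ .inl) (x ∘ .inl) * L p.2 (y ∘ .inr) (x ∘ .inr), fun y x => ?_⟩
    rw [eval_par, hK, hL, Fintype.sum_prod_type, Finset.sum_mul_sum]
    refine Finset.sum_congr rfl fun i _ => Finset.sum_congr rfl fun j _ => ?_
    rw [star_mul']
    ring
  | x => exact unitary _
  | h => exact unitary _
  | t => exact unitary _
  | cnot => exact unitary _
  | toffoli => exact unitary _
  | init =>
    refine ⟨Unit, inferInstance, fun _ y _ => if y () = false then 1 else 0, fun y x => ?_⟩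
    simp only [QCirc.eval]
    by_cases h₁ : y.1 () = false <;> by_cases h₂ : y.2 () = false <;> simp [h₁, h₂]
  | discard =>
    -- Discarding a qubit is the partial trace, with the two Kraus operators `⟨b|`.
    refine ⟨Bits Unit, inferInstance, fun b _ x => if x = b then 1 else 0, fun y x => ?_⟩
    simp only [QCirc.eval]
    by_cases h : x.1 = x.2 <;> simp [h, eq_comm]

/-- In a Kraus decomposition a diagonal entry is a sum of squared moduli. -/
theorem prob_nonneg (c : QCirc α β) (x : Bits α) (y : Bits β) : 0 ≤ c.prob x y := by
  obtain ⟨ι, _, K, hK⟩ := c.exists_kraus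
  rw [prob, hK, Complex.re_sum]
  refine Finset.sum_nonneg fun i _ => ?_
  change 0 ≤ (K i y x * (starRingEnd ℂ) (K i y x)).re
  rw [Complex.mul_conj, Complex.ofReal_re]
  exact Complex.normSq_nonneg _

open Classical in
theorem sum_conjBy_permGate [Fintype (Bits α)] {f : Bits α → Bits α} (hf : f.Injective)
    (x x' : Bits α) : ∑ y, conjBy (permGate f) (y, y) (x, x') = if x = x' then 1 else 0 := by
  simp only [conjBy, permGate, Matrix.of_apply, apply_ite star, star_one, star_zero, ite_mul,
    one_mul, zero_mul, Finset.sum_ite_eq', Finset.mem_univ, if_true,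
    hf.eq_iff]

open Classical in
/-- Every circuit preserves the trace. -/
theorem sum_eval_diag [h : Fintype (Bits β)] (c : QCirc α β) (x x' : Bits α) :
    ∑ y, c.eval (y, y) (x, x') = if x = x' then 1 else 0 := by
  revert h x x'
  induction c with
  | @wire α β e =>
    intro _ x x'
    simp only [eval_wire]
    have key (y : Bits β) : (y ∘ e = x ∧ y ∘ e = x') ↔ (y = x ∘ e.symm ∧ x = x') := by
      rw [Equiv.eq_comp_symm]
      constructor
      · rintro ⟨h, h'⟩; exact ⟨h, h.symm.trans h'⟩
      · rintro ⟨h, h'⟩; exact ⟨h, h.trans h'⟩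
    simp_rw [key, ite_and]
    simp
  | @seq α β γ _ _ c d hc hd =>
    intro _ x x'
    simp_rw [eval_seq]
    rw [Finset.sum_comm]
    simp_rw [Finset.sum_comm (γ := Bits γ), ← Finset.sum_mul, hd, ite_mul, one_mul, zero_mul,
      Finset.sum_ite_eq, Finset.mem_univ, if_true]
    exact hc x x'
  | @par α β γ δ c d hc hd =>
    intro h x x'
    -- Only the joint output strings are known to be finite; those of each factor are their images
    -- under restriction.
    have : Fintype (Bits β) := Fintype.ofSurjective (fun z : Bits (β ⊕ δ) => z ∘ Sum.inl)
      fun y => ⟨Sum.elim y fun _ => false, rfl⟩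
    have : Fintype (Bits δ) := Fintype.ofSurjective (fun z : Bits (β ⊕ δ) => z ∘ Sum.inr)
      fun y => ⟨Sum.elim (fun _ => false) y, rfl⟩
    rw [sum_bits_sum]
    simp only [eval_par, Sum.elim_comp_inl, Sum.elim_comp_inr]
    rw [← Finset.sum_mul_sum, hc, hd, bits_sum_ext_iff (x := x)]
    split_ifs <;> simp_all
  | x =>
    intro _ x x'
    refine sum_conjBy_permGate (fun a b h => ?_) x x'
    have := congrFun h ()
    exact bits_unit_eq_iff.2 (by simpa using this)
  | h =>
    intro _ x x'
    have h2 : ((Real.sqrt 2 : ℝ) : ℂ) * (Real.sqrt 2 : ℝ) = 2 := by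
      rw [← Complex.ofReal_mul, Real.mul_self_sqrt (by norm_num)]; norm_num
    simp only [QCirc.eval]
    rw [sum_bits_unit, bits_unit_eq_iff]
    simp only [conjBy, hadamard, Matrix.of_apply]
    cases x () <;> cases x' () <;> simp <;> field_simp <;> simp [pow_two, h2] <;> norm_num
  | t =>
    intro _ x x'
    simp only [QCirc.eval]
    rw [sum_bits_unit, bits_unit_eq_iff]
    simp only [conjBy, tGate, Matrix.of_apply, bits_unit_eq_iff]
    cases x () <;> cases x' () <;> simp
    rw [← Complex.exp_conj, ← Complex.exp_add]
    simp [show (starRingEnd ℂ) 4 = 4 from map_ofNat _ 4]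
  | cnot =>
    intro _ x x'
    refine sum_conjBy_permGate (fun a b h => ?_) x x'
    have h1 := congrFun h (.inl ())
    have h2 := congrFun h (.inr ())
    simp only [Sum.elim_inl, Sum.elim_inr] at h1 h2
    funext i
    rcases i with _ | _
    · exact h1
    · rw [h1] at h2; simpa using h2
  | toffoli =>
    intro _ x x'
    refine sum_conjBy_permGate (fun a b h => ?_) x x'
    have h1 := congrFun h (.inl ())
    have h2 := congrFun h (.inr (.inl ()))
    have h3 := congrFun h (.inr (.inr ()))
    simp only [Sum.elim_inl, Sum.elim_inr] at h1 h2 h3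
    funext i
    rcases i with _ | _ | _
    · exact h1
    · exact h2
    · rw [h1, h2] at h3; simpa using h3
  | init =>
    intro _ x x'
    rw [sum_bits_unit, if_pos (Subsingleton.elim _ _)]
    simp [QCirc.eval]
  | discard =>
    intro _ x x'
    simp [QCirc.eval]

theorem sum_prob [Fintype (Bits β)] (c : QCirc α β) (x : Bits α) : ∑ y, c.prob x y = 1 := by
  simp only [prob]
  rw [← Complex.re_sum, sum_eval_diag, if_pos rfl, Complex.one_re]

theorem prob_le_one [Fintype (Bits β)] (c : QCirc α β) (x : Bits α) (y : Bits β) :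
    c.prob x y ≤ 1 := by
  rw [← c.sum_prob x]
  exact Finset.single_le_sum (fun z _ => c.prob_nonneg x z) (Finset.mem_univ y)

end QCirc

/-! ### Classical computation by quantum circuits -/

/-- The indicator of a proposition. -/
def ind (p : Prop) : ℂ := open Classical in if p then 1 else 0

theorem ind_true {p : Prop} (h : p) : ind p = 1 := if_pos h

theorem ind_false {p : Prop} (h : ¬ p) : ind p = 0 := if_neg h

theorem ite_eq_ind (p : Prop) {_ : Decidable p} : (if p then 1 else 0 : ℂ) = ind p := by
  unfold ind
  split_ifs <;> rfl

theorem ind_and (p q : Prop) : ind (p ∧ q) = ind p * ind q := by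
  by_cases hp : p <;> by_cases hq : q <;> simp [ind, hp, hq]

theorem ind_congr {p q : Prop} (h : p ↔ q) : ind p = ind q := by rw [propext h]

theorem ind_bits_sum {α β : Type} (x y : Bits (α ⊕ β)) :
    ind (x = y) = ind (x ∘ Sum.inl = y ∘ Sum.inl) * ind (x ∘ Sum.inr = y ∘ Sum.inr) := by
  rw [← ind_and, ind_congr bits_sum_ext_iff]

theorem sum_mul_ind {ι : Type} [Fintype ι] (a : ι) (f : ι → ℂ) :
    ∑ i, f i * ind (i = a) = f a := by
  classical
  simp [ind]

theorem sum_ind_mul {ι : Type} [Fintype ι] (a : ι) (f : ι → ℂ) :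
    ∑ i, ind (i = a) * f i = f a := by
  simp_rw [mul_comm (ind _), sum_mul_ind]

theorem sum_sum_mul_ind {ι κ : Type} [Fintype ι] [Fintype κ] (a : ι) (b : κ) (f : ι → κ → ℂ) :
    ∑ i, ∑ j, f i j * (ind (i = a) * ind (j = b)) = f a b := by
  simp_rw [← mul_assoc, sum_mul_ind]

/-- Registers are indexed by arbitrary finite types. Constructions that go qubit by qubit need this
induction, which builds every finite type from `Empty` by adding single points, up to equivalence.
-/
theorem finite_induction_sum_unit {P : Type → Prop}
    (of_equiv : ∀ {α β : Type} [Finite α] [Finite β], α ≃ β → P α → P β) (empty : P Empty)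
    (sum_unit : ∀ {α : Type} [Finite α], P α → P (α ⊕ Unit)) (α : Type) [Finite α] : P α := by
  have h (n : ℕ) : P (Fin n) := by
    induction n with
    | zero => exact of_equiv (Equiv.equivOfIsEmpty Empty (Fin 0)) empty
    | succ n ih =>
      exact of_equiv ((Equiv.sumCongr (Equiv.refl (Fin n))
        (Equiv.ofUnique Unit (Fin 1))).trans finSumFinEquiv) (sum_unit ih)
  exact of_equiv (Finite.equivFin α).symm (h _)

namespace QCirc

variable {α β γ δ : Type}

@[simp]
theorem size_wire (e : α ≃ β) : (wire e).size = 0 := rfl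

@[simp]
theorem size_seq [Fintype β] [DecidableEq β] (c : QCirc α β) (d : QCirc β γ) :
    (seq c d).size = c.size + d.size := rfl

@[simp]
theorem size_par (c : QCirc α β) (d : QCirc γ δ) : (par c d).size = c.size + d.size := rfl

theorem eval_wire_eq_ind (e : α ≃ β) (y y' : Bits β) (x : Bits α × Bits α) :
    (wire e).eval (y, y') x = ind (y = x.1 ∘ e.symm) * ind (y' = x.2 ∘ e.symm) := by
  rw [eval_wire, ite_eq_ind, ind_and]
  simp only [Equiv.eq_comp_symm]

theorem eval_wire_seq [Fintype β] [DecidableEq β] (e : α ≃ β) (d : QCirc β γ)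
    (z : Bits γ × Bits γ) (x : Bits α × Bits α) :
    (seq (wire e) d).eval z x = d.eval z (x.1 ∘ e.symm, x.2 ∘ e.symm) := by
  rw [eval_seq]
  simp_rw [eval_wire_eq_ind, sum_sum_mul_ind]

theorem eval_seq_wire [Fintype β] [DecidableEq β] (c : QCirc α β) (e : β ≃ γ)
    (z : Bits γ × Bits γ) (x : Bits α × Bits α) :
    (seq c (wire e)).eval z x = c.eval (z.1 ∘ e, z.2 ∘ e) x := by
  rw [eval_seq]
  simp_rw [eval_wire, ite_eq_ind, ind_and, eq_comm (a := _ ∘ e)]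
  simp_rw [mul_comm _ (c.eval _ _), sum_sum_mul_ind]

/-- On a classical input `x` the circuit outputs the classical string `f x`. -/
def Computes (c : QCirc α β) (f : Bits α → Bits β) : Prop :=
  ∀ x y y', c.eval (y, y') (x, x) = ind (y = f x) * ind (y' = f x)

theorem computes_wire (e : α ≃ β) : (wire e).Computes fun x => x ∘ e.symm :=
  fun _ _ _ => eval_wire_eq_ind _ _ _ _

/-- On a classical input such a circuit may simply be replaced by its function. Nothing is known
about its action on coherences, so a register that may be in superposition has to be measured before
the rule is applied. -/
theorem Computes.eval_seq [Fintype β] [DecidableEq β] {c : QCirc α β} {f : Bits α → Bits β}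
    (hc : c.Computes f) (d : QCirc β γ) (z : Bits γ × Bits γ) (x : Bits α) :
    (seq c d).eval z (x, x) = d.eval z (f x, f x) := by
  rw [QCirc.eval_seq]
  simp_rw [hc x, sum_sum_mul_ind]

theorem Computes.seq [Fintype β] [DecidableEq β] {c : QCirc α β} {f : Bits α → Bits β}
    {d : QCirc β γ} {g : Bits β → Bits γ} (hc : c.Computes f) (hd : d.Computes g) :
    (seq c d).Computes (g ∘ f) := by
  intro x y y'
  rw [hc.eval_seq, hd]
  rfl

theorem Computes.par {c : QCirc α β} {f : Bits α → Bits β} {d : QCirc γ δ}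
    {g : Bits γ → Bits δ} (hc : c.Computes f) (hd : d.Computes g) :
    (par c d).Computes fun x => Sum.elim (f (x ∘ .inl)) (g (x ∘ .inr)) := by
  intro x y y'
  rw [eval_par, hc, hd, ind_bits_sum y, ind_bits_sum y']
  simp only [Sum.elim_comp_inl, Sum.elim_comp_inr]
  ring

theorem conjBy_permGate (f : Bits α → Bits α) (y y' : Bits α) (x : Bits α × Bits α) :
    conjBy (permGate f) (y, y') x = ind (y = f x.1) * ind (y' = f x.2) := by
  simp only [conjBy, permGate, Matrix.of_apply, ite_eq_ind]
  congr 1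
  unfold ind
  split_ifs <;> simp

theorem computes_x : QCirc.x.Computes fun b _ => !b () := fun _ _ _ => conjBy_permGate _ _ _ _

theorem eval_cnot (y y' : Bits (Unit ⊕ Unit)) (x : Bits (Unit ⊕ Unit) × Bits (Unit ⊕ Unit)) :
    cnot.eval (y, y') x =
      ind (y = Sum.elim (fun _ => x.1 (.inl ())) (fun _ => xor (x.1 (.inr ())) (x.1 (.inl ())))) *
      ind (y' = Sum.elim (fun _ => x.2 (.inl ())) (fun _ => xor (x.2 (.inr ())) (x.2 (.inl ())))) :=
  conjBy_permGate _ _ _ _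

theorem computes_cnot : QCirc.cnot.Computes fun b =>
    Sum.elim (fun _ => b (.inl ())) (fun _ => xor (b (.inr ())) (b (.inl ()))) :=
  fun _ _ _ => eval_cnot _ _ _

theorem computes_toffoli : QCirc.toffoli.Computes fun b =>
    Sum.elim (fun _ => b (.inl ())) (Sum.elim (fun _ => b (.inr (.inl ())))
      (fun _ => xor (b (.inr (.inr ()))) (b (.inl ()) && b (.inr (.inl ()))))) :=
  fun _ _ _ => conjBy_permGate _ _ _ _

theorem eval_init (y y' : Bits Unit) (x : Bits Empty × Bits Empty) :
    init.eval (y, y') x = ind (y = fun _ => false) * ind (y' = fun _ => false) := by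
  simp only [← ind_and, QCirc.eval, ite_eq_ind, bits_unit_eq_iff]

theorem computes_init : QCirc.init.Computes fun _ _ => false := fun _ _ _ => eval_init _ _ _

theorem eval_discard (y : Bits Empty × Bits Empty) (x : Bits Unit × Bits Unit) :
    discard.eval y x = ind (x.1 = x.2) := by
  simp only [QCirc.eval, ite_eq_ind]

theorem computes_discard : QCirc.discard.Computes fun _ => Empty.elim := by
  intro x y y'
  rw [eval_discard, ind_true rfl, ind_true (Subsingleton.elim _ _),
    ind_true (Subsingleton.elim _ _), one_mul]

end QCirc

/-- `f` is computed by a circuit with at most `N` gates. -/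
def ComputableWithin {α β : Type} (f : Bits α → Bits β) (N : ℕ) : Prop :=
  ∃ c : QCirc α β, c.Computes f ∧ c.size ≤ N

namespace ComputableWithin

variable {α β γ δ : Type}

theorem mono {f : Bits α → Bits β} {M N : ℕ} (h : ComputableWithin f M) (hMN : M ≤ N) :
    ComputableWithin f N :=
  let ⟨c, hc, hs⟩ := h
  ⟨c, hc, hs.trans hMN⟩

theorem wire (e : α ≃ β) : ComputableWithin (fun x : Bits α => x ∘ e.symm) 0 :=
  ⟨.wire e, QCirc.computes_wire e, le_rfl⟩

theorem comp [Finite β] {f : Bits α → Bits β} {g : Bits β → Bits γ} {M N : ℕ}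
    (hg : ComputableWithin g N) (hf : ComputableWithin f M) :
    ComputableWithin (g ∘ f) (M + N) := by
  classical
  have := Fintype.ofFinite β
  obtain ⟨c, hc, hcs⟩ := hf
  obtain ⟨d, hd, hds⟩ := hg
  exact ⟨.seq c d, hc.seq hd, add_le_add hcs hds⟩

theorem par {f : Bits α → Bits β} {g : Bits γ → Bits δ} {M N : ℕ}
    (hf : ComputableWithin f M) (hg : ComputableWithin g N) :
    ComputableWithin (fun x : Bits (α ⊕ γ) => Sum.elim (f (x ∘ .inl)) (g (x ∘ .inr))) (M + N) := by
  obtain ⟨c, hc, hcs⟩ := hf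
  obtain ⟨d, hd, hds⟩ := hg
  exact ⟨.par c d, hc.par hd, add_le_add hcs hds⟩

theorem comp_wire [Finite α] {f : Bits β → Bits γ} {N : ℕ} (hf : ComputableWithin f N)
    (e : α ≃ β) : ComputableWithin (fun x : Bits α => f (x ∘ e.symm)) N := by
  have := Finite.of_equiv α e
  exact (hf.comp (wire e)).mono (zero_add N).le

theorem wire_comp [Finite β] {f : Bits α → Bits β} {N : ℕ} (hf : ComputableWithin f N)
    (e : β ≃ γ) : ComputableWithin (fun x : Bits α => f x ∘ e.symm) N := by
  exact ((wire e).comp hf).mono (add_zero N).le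

theorem not : ComputableWithin (fun (x : Bits Unit) (_ : Unit) => !x ()) 1 :=
  ⟨.x, QCirc.computes_x, le_rfl⟩

/-- Discarding the whole register. -/
theorem discard (α : Type) [Finite α] :
    ComputableWithin (fun _ : Bits α => (Empty.elim : Bits Empty)) (Nat.card α) := by
  induction α using finite_induction_sum_unit with
  | of_equiv e ih =>
    rw [← Nat.card_congr e]
    exact ih.comp_wire e.symm
  | empty =>
    convert wire (Equiv.refl Empty) using 1
    simp
  | sum_unit ih =>
    have h₁ : ComputableWithin (fun _ : Bits Unit => (Empty.elim : Bits Empty)) 1 :=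
      ⟨.discard, QCirc.computes_discard, le_rfl⟩
    have h₂ := (ih.par h₁).wire_comp (Equiv.sumEmpty Empty Empty)
    rw [Nat.card_sum, Nat.card_unique (α := Unit)]
    convert h₂ using 1

/-- Adding a fresh qubit. -/
theorem append_zero (α : Type) [Finite α] :
    ComputableWithin (fun x : Bits α => (Sum.elim x fun _ => false : Bits (α ⊕ Unit))) 1 := by
  have h : ComputableWithin (fun (_ : Bits Empty) (_ : Unit) => false) 1 :=
    ⟨.init, QCirc.computes_init, le_rfl⟩
  exact ((wire (Equiv.refl α)).par h).comp_wire (Equiv.sumEmpty α Empty).symm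

/-- A CNOT onto a fresh qubit copies a basis state; the two gates are the fresh qubit and the CNOT.
-/
theorem copy_bit : ComputableWithin (fun x : Bits Unit => (Sum.elim x x : Bits (Unit ⊕ Unit))) 2 := by
  have h : ComputableWithin _ 1 := ⟨.cnot, QCirc.computes_cnot, le_rfl⟩
  convert h.comp (append_zero Unit) using 1
  funext x i
  rcases i with _ | _ <;> simp

/-- Copying a classical register. -/
theorem copy (α : Type) [Finite α] :
    ComputableWithin (fun x : Bits α => (Sum.elim x x : Bits (α ⊕ α))) (2 * Nat.card α) := by
  induction α using finite_induction_sum_unit with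
  | of_equiv e ih =>
    rw [← Nat.card_congr e]
    convert (ih.comp_wire e.symm).wire_comp (Equiv.sumCongr e e) using 1
    funext x i
    rcases i with _ | _ <;> simp
  | empty =>
    convert wire (Equiv.sumEmpty Empty Empty).symm using 1
    · funext x i
      rcases i with i | i <;> exact i.elim
    · simp
  | sum_unit ih =>
    rename_i α _
    have h := (ih.par copy_bit).wire_comp (Equiv.sumSumSumComm α α Unit Unit)
    rw [Nat.card_sum, Nat.card_unique (α := Unit), mul_add]
    convert h using 1
    funext x i
    rcases i with (i | _) | (i | _) <;> rfl

/-- A Toffoli gate writes the conjunction onto a fresh qubit, and the two inputs are then discarded: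
four gates. -/
theorem and_bit :
    ComputableWithin (fun (x : Bits (Unit ⊕ Unit)) (_ : Unit) => x (.inl ()) && x (.inr ())) 4 := by
  have h : ComputableWithin _ 1 := ⟨.toffoli, QCirc.computes_toffoli, le_rfl⟩
  have h₁ := h.comp ((append_zero (Unit ⊕ Unit)).wire_comp (Equiv.sumAssoc Unit Unit Unit))
  have h₂ := ((discard (Unit ⊕ Unit)).par (wire (Equiv.refl Unit))).comp
    (h₁.wire_comp (Equiv.sumAssoc Unit Unit Unit).symm)
  have h₃ := h₂.wire_comp (Equiv.emptySum Empty Unit)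
  convert h₃ using 1
  · funext x i
    simp
  · simp

/-! ### Computations on copies of the input -/

section Fan

variable [Finite α]

/-- Running two computations on copies of the input. -/
theorem pair {f : Bits α → Bits β} {g : Bits α → Bits γ} {M N : ℕ}
    (hf : ComputableWithin f M) (hg : ComputableWithin g N) :
    ComputableWithin (fun x => Sum.elim (f x) (g x)) (2 * Nat.card α + M + N) := by
  rw [add_assoc]
  exact (hf.par hg).comp (copy α)

theorem const_bit (b : Bool) :
    ComputableWithin (fun (_ : Bits α) (_ : Unit) => b) (Nat.card α + 2) := by
  have h : ComputableWithin (fun (_ : Bits Empty) (_ : Unit) => false) 1 :=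
    ⟨.init, QCirc.computes_init, le_rfl⟩
  cases b
  · exact (h.comp (discard α)).mono (by omega)
  · exact (not.comp (h.comp (discard α))).mono (by omega)

theorem bit (i : α) : ComputableWithin (fun (x : Bits α) (_ : Unit) => x i) (Nat.card α) := by
  classical
  let e : Unit ⊕ {j // ¬ j = i} ≃ α :=
    (Equiv.sumCongr (Equiv.ofUnique Unit {j // j = i}) (Equiv.refl _)).trans
      (Equiv.sumCompl fun j => j = i)
  have h := (((wire (Equiv.refl Unit)).par (discard {j // ¬ j = i})).comp_wire e.symm).wire_comp
    (Equiv.sumEmpty Unit Empty)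
  refine (show ComputableWithin _ _ from ?_ : ComputableWithin _ (0 + Nat.card {j // ¬ j = i})).mono
    (by rw [zero_add]; exact Finite.card_subtype_le _)
  convert h using 1
  funext x _
  exact congrArg x ((Equiv.ofUnique Unit {j // j = i}) ()).2.symm

/-- A function is computable if its output bits are. -/
theorem pi [Finite β] {f : Bits α → Bits β} {N : ℕ}
    (hf : ∀ j, ComputableWithin (fun x (_ : Unit) => f x j) N) :
    ComputableWithin f (Nat.card β * (2 * Nat.card α + N) + Nat.card α) := by
  induction β using finite_induction_sum_unit with
  | of_equiv e ih =>
    rw [← Nat.card_congr e]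
    convert (ih fun j => (hf (e j) : ComputableWithin (fun x _ => (f x ∘ e) j) N)).wire_comp e
      using 1
    funext x i
    simp
  | empty =>
    convert discard α using 1
    simp
  | sum_unit ih =>
    -- Each output bit is computed from its own copy of the input, at cost `2 * Nat.card α + N`. The
    -- copy that remains at the end is discarded in the base case.
    have h := (ih fun j => (hf (.inl j) : ComputableWithin (fun x _ => (f x ∘ .inl) j) N)).pair
      (hf (.inr ()))
    rw [Nat.card_sum, Nat.card_unique (α := Unit)]
    convert h using 1
    · funext x i
      rcases i with _ | i <;> rfl
    · ring

theorem const (y : Bits β) [Finite β] :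
    ComputableWithin (fun _ : Bits α => y) (Nat.card β * (3 * Nat.card α + 2) + Nat.card α) :=
  (pi fun j => const_bit (y j)).mono (le_of_eq (by ring))

/-- The conjunction of the bits in `S`. -/
theorem all_bits (S : Finset α) :
    ComputableWithin (fun (x : Bits α) (_ : Unit) => decide (∀ i ∈ S, x i = true))
      (S.card * (3 * Nat.card α + 4) + Nat.card α + 2) := by
  classical
  induction S using Finset.induction_on with
  | empty =>
    convert const_bit (α := α) true using 1
    · simp
    · simp
  | insert i S hi ih =>
    -- With `a` input bits, one more conjunct costs `2 * a` gates for a copy, `a` for reading a bit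
    -- and 4 for the conjunction.
    have h := and_bit.comp ((bit i).pair ih)
    rw [Finset.card_insert_of_notMem hi]
    convert h using 1
    · funext x _
      simp
    · ring

/-- A NAND gate reading the wires in `S`. -/
theorem nand_bits (S : Set α) :
    ComputableWithin (fun (x : Bits α) (_ : Unit) => nand (∀ i ∈ S, x i = true))
      (Nat.card α * (3 * Nat.card α + 4) + Nat.card α + 3) := by
  classical
  have := Fintype.ofFinite α
  have h := not.comp (all_bits S.toFinset)
  have hS : S.toFinset.card ≤ Nat.card α := by
    rw [Nat.card_eq_fintype_card]; exact Finset.card_le_univ _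
  refine (show ComputableWithin _ _ from ?_ : ComputableWithin _
    (S.toFinset.card * (3 * Nat.card α + 4) + Nat.card α + 2 + 1)).mono
      (by have := Nat.mul_le_mul_right (3 * Nat.card α + 4) hS; omega)
  convert h using 1
  funext x _
  simp [nand, -not_forall, decide_not]

end Fan

/-- The cost of computing a gate, or a string of copies of inputs and gates. -/
def layerCost (a b : ℕ) : ℕ := b * (2 * a + (a * (3 * a + 4) + a + 3)) + a

theorem layerCost_mono {a a' b b' : ℕ} (ha : a ≤ a') (hb : b ≤ b') :
    layerCost a b ≤ layerCost a' b' := by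
  unfold layerCost
  gcongr

variable {ι o : Type} [Finite ι]

/-- The first `k` gates of a Boolean circuit can be computed. -/
theorem gates {s : ℕ} (C : BCirc ι s o) (k : ℕ) (hk : k ≤ s) :
    ComputableWithin
      (fun x => (Sum.elim x fun j => C.gate x (Fin.castLE hk j) : Bits (ι ⊕ Fin k)))
      (k * layerCost (Nat.card ι + s) (Nat.card ι + s)) := by
  induction k with
  | zero =>
    convert wire (Equiv.sumEmpty ι (Fin 0)).symm using 1
    · funext x i
      rcases i with i | i
      · rfl
      · exact i.elim0
    · simp
  | succ k ih =>
    have h₀ := ih (by omega)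
    let g : Fin s := ⟨k, hk⟩
    -- One layer passes on all wires computed so far and appends gate `k`. These wires suffice
    -- because a gate reads only inputs and earlier gates.
    let F : Bits (ι ⊕ Fin k) → Bits (ι ⊕ Fin (k + 1)) := fun z =>
      Sum.elim (z ∘ .inl) (Fin.snoc (α := fun _ => Bool) (z ∘ .inr)
        (nand (∀ i ∈ {i : ι ⊕ Fin k | C (.inl g, i.map id (Fin.castLE (by omega))) = true},
          z i = true)))
    have hF : ComputableWithin F (layerCost (Nat.card ι + s) (Nat.card ι + s)) := by
      refine (pi (N := Nat.card (ι ⊕ Fin k) * (3 * Nat.card (ι ⊕ Fin k) + 4) +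
        Nat.card (ι ⊕ Fin k) + 3) fun j => ?_).mono ?_
      · have hbit (i : ι ⊕ Fin k) : ComputableWithin (fun (z : Bits (ι ⊕ Fin k)) (_ : Unit) => z i)
            (Nat.card (ι ⊕ Fin k) * (3 * Nat.card (ι ⊕ Fin k) + 4) +
              Nat.card (ι ⊕ Fin k) + 3) :=
          (bit i).mono (by omega)
        rcases j with j | j
        · exact hbit (.inl j)
        · refine Fin.lastCases ?_ (fun j => ?_) j
          · simp only [F, Sum.elim_inr, Fin.snoc_last]
            exact nand_bits _
          · simp only [F, Sum.elim_inr, Fin.snoc_castSucc]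
            exact hbit (.inr j)
      · rw [Nat.card_sum, Nat.card_sum, Nat.card_fin, Nat.card_fin]
        exact layerCost_mono (by omega) (by omega)
    rw [add_mul, one_mul]
    convert hF.comp h₀ using 1
    funext x i
    rcases i with i | i
    · rfl
    · refine Fin.lastCases ?_ (fun j => ?_) i
      · simp only [F, Function.comp_apply, Sum.elim_inr, Fin.snoc_last]
        change C.gate x g = _
        rw [BCirc.gate]
        congr 1
        apply propext
        constructor
        · rintro ⟨h₁, h₂⟩ (i | j) hi
          · exact h₁ i hi
          · exact h₂ ⟨Fin.castLE (by omega) j, j.2⟩ hi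
        · intro h
          refine ⟨fun i hi => h (.inl i) hi, fun j hj => ?_⟩
          exact h (.inr ⟨j.1, j.2⟩) hj
      · simp only [F, Function.comp_apply, Sum.elim_inr, Fin.snoc_castSucc]
        rfl

/-- Boolean circuits can be run on a quantum computer. -/
theorem of_bcirc [Finite o] {s : ℕ} (C : BCirc ι s o) :
    ComputableWithin C.eval
      (s * layerCost (Nat.card ι + s) (Nat.card ι + s) +
        layerCost (Nat.card ι + s) (Nat.card o)) := by
  have h₀ := gates C s le_rfl
  let F : Bits (ι ⊕ Fin s) → Bits o := fun z y =>
    nand (∀ i ∈ {i : ι ⊕ Fin s | C (.inr y, i) = true}, z i = true)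
  have hF : ComputableWithin F (layerCost (Nat.card ι + s) (Nat.card o)) := by
    refine (pi (fun j => nand_bits _)).mono ?_
    rw [Nat.card_sum, Nat.card_fin]
    rfl
  convert hF.comp h₀ using 1
  funext x y
  simp only [F, Function.comp_apply, BCirc.eval]
  congr 1
  apply propext
  constructor
  · rintro ⟨h₁, h₂⟩ (i | j) hi
    · exact h₁ i hi
    · exact h₂ j hi
  · intro h
    exact ⟨fun i hi => h (.inl i) hi, fun j hj => h (.inr j) hj⟩

end ComputableWithin

-- This is the passage from classical to quantum polynomial time along a sequence of parameters. If
-- `P` bounds the size and both lengths of the Boolean circuit, then `P * L + L` gates suffice,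
-- where `L` is the cost of a layer with `2 * P` wires. The polynomial bounds on the lengths are
-- what later controls keys and ciphertexts.
open ComputableWithin in
theorem PolyComputable.computableWithin {J : Type} {w : J → ℕ} {ι o : J → Type}
    [∀ j, Fintype (ι j)] [∀ j, Fintype (o j)] {f : ∀ j, Bits (ι j) → Bits (o j)}
    (hf : PolyComputable w f) {j : ℕ → J} (hj : PolyBounded fun n => w (j n)) :
    ∃ N : ℕ → ℕ, PolyBounded N ∧ (∀ n, ComputableWithin (f (j n)) (N n)) ∧
      PolyBounded (fun n => Fintype.card (ι (j n))) ∧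
      PolyBounded (fun n => Fintype.card (o (j n))) := by
  obtain ⟨p, hp⟩ := hf
  have hP := hj.polynomial_eval p
  set P : ℕ → ℕ := fun n => p.eval (w (j n)) with hPdef
  have hL : PolyBounded fun n => layerCost (P n + P n) (P n + P n) := by
    unfold layerCost
    exact (((hP.add hP).mul (((PolyBounded.const 2).mul (hP.add hP)).add
      ((((hP.add hP).mul (((PolyBounded.const 3).mul (hP.add hP)).add
        (PolyBounded.const 4))).add (hP.add hP)).add (PolyBounded.const 3)))).add (hP.add hP))
  refine ⟨_, (hP.mul hL).add hL, fun n => ?_, hP.mono fun n => (hp _).1,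
    hP.mono fun n => (hp _).2.1⟩
  obtain ⟨h₁, h₂, s, hs, C, hC⟩ := hp (j n)
  have hCf : C.eval = f (j n) := funext hC
  rw [← hCf]
  refine (of_bcirc C).mono ?_
  rw [Nat.card_eq_fintype_card, Nat.card_eq_fintype_card]
  have hi : Fintype.card (ι (j n)) + s ≤ P n + P n := add_le_add h₁ hs
  exact add_le_add (Nat.mul_le_mul hs (layerCost_mono hi hi))
    (layerCost_mono hi (h₂.trans (Nat.le_add_left _ _)))

namespace ComputableWithin

variable {α : Type} [Finite α]

/-- A function of one input bit. -/
theorem of_bit (i : α) (g : Bool → Bool) :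
    ComputableWithin (fun (x : Bits α) (_ : Unit) => g (x i)) (Nat.card α + 2) := by
  cases h₀ : g false <;> cases h₁ : g true
  · convert const_bit (α := α) false using 3 with x
    cases x i <;> assumption
  · convert (bit i).mono (Nat.le_add_right _ 2) using 3 with x
    cases x i <;> assumption
  · convert (not.comp (bit i)).mono (Nat.add_le_add_left one_le_two _) using 3 with x
    simp only [Function.comp_apply]
    cases x i <;> assumption
  · convert const_bit (α := α) true using 3 with x
    cases x i <;> assumption

/-- The cost of a comparison of `a` bits with a fixed string. -/
def eqCost (a : ℕ) : ℕ :=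
  (a * (3 * a + 2) + a) + (a * (3 * a + 4) + a + 3) + 1

/-- Comparison with a fixed string. -/
theorem eq_const (m : Bits α) :
    ComputableWithin (fun (x : Bits α) (_ : Unit) => nand (x ≠ m))
      (eqCost (Nat.card α)) := by
  -- Since `nand P` is the truth value of `¬ P`, the Boolean `nand (x ≠ m)` is that of `x = m`. It
  -- is the conjunction of the bitwise comparisons, obtained as a NAND followed by a NOT.
  have h : ComputableWithin (fun (x : Bits α) i => x i == m i)
      (Nat.card α * (3 * Nat.card α + 2) + Nat.card α) :=
    (pi fun i => of_bit i (· == m i)).mono (le_of_eq (by ring))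
  unfold eqCost
  convert not.comp ((nand_bits Set.univ).comp h) using 1
  funext x _
  simp [nand, funext_iff]

theorem xor_bit :
    ComputableWithin (fun (x : Bits (Unit ⊕ Unit)) (_ : Unit) =>
      xor (x (.inr ())) (x (.inl ()))) 2 := by
  have h : ComputableWithin _ 1 := ⟨.cnot, QCirc.computes_cnot, le_rfl⟩
  have h₁ := ((((discard Unit).par (wire (Equiv.refl Unit))).comp h).wire_comp
    (Equiv.emptySum Empty Unit))
  exact h₁.mono (by simp)

end ComputableWithin

namespace QCirc

variable {α β γ δ : Type}

/-! ### Composition rules -/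

theorem eval_parWire_seq [Fintype β] [DecidableEq β] [Fintype γ] [DecidableEq γ] (c : QCirc α β)
    (d : QCirc (β ⊕ γ) δ) (z : Bits δ × Bits δ) (x : Bits (α ⊕ γ) × Bits (α ⊕ γ)) :
    (seq (par c (wire (Equiv.refl γ))) d).eval z x =
      ∑ y, ∑ y', d.eval z (Sum.elim y (x.1 ∘ .inr), Sum.elim y' (x.2 ∘ .inr)) *
        c.eval (y, y') (x.1 ∘ .inl, x.2 ∘ .inl) := by
  rw [eval_seq]
  simp_rw [sum_bits_sum (α := β), eval_par, eval_wire_eq_ind, Sum.elim_comp_inl,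
    Sum.elim_comp_inr, ← mul_assoc, sum_mul_ind]
  refine Finset.sum_congr rfl fun y _ => ?_
  rw [Finset.sum_comm]
  simp_rw [sum_mul_ind]
  rfl

theorem eval_wirePar_seq [Fintype β] [DecidableEq β] [Fintype γ] [DecidableEq γ] (c : QCirc α β)
    (d : QCirc (γ ⊕ β) δ) (z : Bits δ × Bits δ) (x : Bits (γ ⊕ α) × Bits (γ ⊕ α)) :
    (seq (par (wire (Equiv.refl γ)) c) d).eval z x =
      ∑ y, ∑ y', d.eval z (Sum.elim (x.1 ∘ .inl) y, Sum.elim (x.2 ∘ .inl) y') *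
        c.eval (y, y') (x.1 ∘ .inr, x.2 ∘ .inr) := by
  rw [eval_seq]
  simp_rw [sum_bits_sum (α := γ), eval_par, eval_wire_eq_ind, Sum.elim_comp_inl,
    Sum.elim_comp_inr, mul_comm (_ * ind _), ← mul_assoc]
  rw [Finset.sum_comm]
  refine Finset.sum_congr rfl fun y _ => ?_
  refine (Finset.sum_congr rfl fun x _ => Finset.sum_comm).trans ?_
  simp_rw [sum_mul_ind]
  rw [Finset.sum_comm]
  simp_rw [sum_mul_ind]
  rfl

theorem Computes.eval_parWire_seq [Fintype β] [DecidableEq β] [Fintype γ] [DecidableEq γ]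
    {c : QCirc α β} {f : Bits α → Bits β} (hc : c.Computes f) (d : QCirc (β ⊕ γ) δ)
    (z : Bits δ × Bits δ) (x : Bits α) (a a' : Bits γ) :
    (QCirc.seq (QCirc.par c (QCirc.wire (Equiv.refl γ))) d).eval z (Sum.elim x a, Sum.elim x a') =
      d.eval z (Sum.elim (f x) a, Sum.elim (f x) a') := by
  rw [QCirc.eval_parWire_seq]
  simp_rw [Sum.elim_comp_inl, Sum.elim_comp_inr, hc x, sum_sum_mul_ind]

/-! ### Measurement -/

/-- A measurement in the computational basis is a CNOT onto a fresh qubit that is then discarded: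
the discarded copy destroys the off-diagonal terms. This takes three gates per qubit. -/
theorem exists_dephase (α : Type) [Finite α] :
    ∃ c : QCirc α α, c.size ≤ 3 * Nat.card α ∧ ∀ y y' x x', c.eval (y, y') (x, x') =
      ind (x = x') * (ind (y = x) * ind (y' = x)) := by
  classical
  induction α using finite_induction_sum_unit with
  | @of_equiv α β _ _ e ih =>
    obtain ⟨c, hcs, hc⟩ := ih
    have := Fintype.ofFinite α
    have := Fintype.ofFinite β
    refine ⟨seq (wire e.symm) (seq c (wire e)), ?_, fun y y' x x' => ?_⟩
    · rw [← Nat.card_congr e]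
      simpa using hcs
    · rw [eval_wire_seq, eval_seq_wire, hc]
      simp only [Equiv.symm_symm, e.surjective.injective_comp_right.eq_iff]
  | empty =>
    refine ⟨wire (Equiv.refl _), by simp, fun y y' x x' => ?_⟩
    obtain rfl : x = x' := Subsingleton.elim _ _
    rw [eval_wire_eq_ind, ind_true (p := x = x) rfl, one_mul]
    rfl
  | @sum_unit α _ ih =>
    obtain ⟨c, hcs, hc⟩ := ih
    let d : QCirc Unit Unit := seq (wire (Equiv.sumEmpty Unit Empty).symm)
      (seq (par (wire (Equiv.refl Unit)) init)
        (seq cnot (seq (par (wire (Equiv.refl Unit)) discard) (wire (Equiv.sumEmpty Unit Empty)))))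
    have hd (y y' x x' : Bits Unit) : d.eval (y, y') (x, x') =
        ind (x = x') * (ind (y = x) * ind (y' = x)) := by
      rw [eval_wire_seq, eval_wirePar_seq]
      simp_rw [eval_init, sum_sum_mul_ind]
      rw [eval_seq]
      simp_rw [eval_cnot, sum_sum_mul_ind, eval_seq_wire, eval_par, eval_wire_eq_ind,
        eval_discard, ← ind_and]
      apply ind_congr
      simp only [bits_unit_eq_iff, Function.comp_apply, Sum.elim_inl, Sum.elim_inr]
      simp
      grind
    refine ⟨par c d, ?_, fun y y' x x' => ?_⟩
    · rw [Nat.card_sum, Nat.card_unique (α := Unit), mul_add]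
      exact add_le_add hcs le_rfl
    · rw [eval_par, hc, hd, ind_bits_sum x x', ind_bits_sum y x, ind_bits_sum y' x]
      ring

/-- A circuit that measures its input and computes `f` on the result. -/
theorem _root_.ComputableWithin.exists_measure [Finite α] {f : Bits α → Bits β} {N : ℕ}
    (hf : ComputableWithin f N) :
    ∃ c : QCirc α β, c.size ≤ 3 * Nat.card α + N ∧ ∀ y y' x x', c.eval (y, y') (x, x') =
      ind (x = x') * (ind (y = f x) * ind (y' = f x)) := by
  classical
  have := Fintype.ofFinite α
  obtain ⟨c, hc, hcs⟩ := hf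
  obtain ⟨d, hds, hd⟩ := exists_dephase α
  refine ⟨seq d c, add_le_add hds hcs, fun y y' x x' => ?_⟩
  rw [eval_seq]
  simp_rw [hd, ← mul_assoc, sum_mul_ind]
  rw [hc]
  ring

/-- A Hadamard gate on a fresh qubit, followed by a measurement, gives the maximally mixed state.
The measurement is needed so that the bit is classical and no coherence between its values survives.
-/
theorem exists_coin : ∃ c : QCirc Empty Unit, c.size ≤ 5 ∧
    ∀ y y' x, c.eval (y, y') x = ind (y = y') * (1 / 2) := by
  obtain ⟨d, hds, hd⟩ := exists_dephase Unit
  rw [Nat.card_unique] at hds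
  refine ⟨seq init (seq h d), ?_, fun y y' x => ?_⟩
  · change 1 + (1 + d.size) ≤ 5
    omega
  have h2 : ((Real.sqrt 2 : ℝ) : ℂ) * (Real.sqrt 2 : ℝ) = 2 := by
    rw [← Complex.ofReal_mul, Real.mul_self_sqrt (by norm_num)]; norm_num
  rw [eval_seq]
  simp_rw [eval_init, sum_sum_mul_ind, eval_seq, hd, sum_bits_unit]
  simp only [QCirc.eval, conjBy, hadamard, Matrix.of_apply, bits_unit_eq_iff, ind]
  cases y () <;> cases y' () <;> simp <;> field_simp <;> simp [pow_two, h2]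

/-- Preparing a fixed string. -/
theorem exists_const [Finite β] (y : Bits β) :
    ∃ c : QCirc Empty β, c.Computes (fun _ => y) ∧ c.size ≤ 2 * Nat.card β := by
  obtain ⟨c, hc, hcs⟩ := ComputableWithin.const (α := Empty) y
  exact ⟨c, hc, hcs.trans (by simp [mul_comm])⟩

end QCirc

/-! ### The circuits of the reductions -/

theorem single_eq_ind {ι : Type} [DecidableEq ι] (a b b' : ι) :
    Matrix.single a a (1 : ℂ) b b' = ind (b = a) * ind (b' = a) := by
  rw [Matrix.single_apply, ite_eq_ind, ind_and, ind_congr (eq_comm (a := a) (b := b)),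
    ind_congr (eq_comm (a := a) (b := b'))]

/-- The state `|c⟩⟨c| ⊗ ρ`. -/
def tagged {γ τ : Type} (c : Bits γ) (ρ : Op τ) : Op (γ ⊕ τ) :=
  Matrix.of fun y y' =>
    ρ (y ∘ Sum.inr) (y' ∘ Sum.inr) * (ind (y ∘ Sum.inl = c) * ind (y' ∘ Sum.inl = c))

/-- The output state of a circuit on a classical input. -/
def QCirc.outState {α β : Type} (c : QCirc α β) (x : Bits α) : Op β :=
  Matrix.of fun i j => c.eval (i, j) (x, x)

theorem QCirc.trace_outState {α β : Type} [Fintype β] [DecidableEq β] (c : QCirc α β)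
    (x : Bits α) : (c.outState x).trace = 1 := by
  classical
  simp only [Matrix.trace, Matrix.diag, outState, Matrix.of_apply]
  rw [c.sum_eval_diag, if_pos rfl]

namespace QCirc

variable {ι o α β γ δ : Type}

/-- The trace of the memory is the weight of the transcript so far. Summing over the next message
undoes the measurement, so trace preservation applies. -/
theorem sum_trace_step [Fintype o] [DecidableEq o] [Fintype α] [DecidableEq α] [Fintype β]
    [DecidableEq β] (c : QCirc (ι ⊕ α) (o ⊕ β)) (x : Bits ι) (ρ : Op α) :
    ∑ y, (c.step x y ρ).trace = ρ.trace := by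
  classical
  have h (a a' : Bits α) : ∑ y : Bits o, ∑ i : Bits β,
      c.eval (Sum.elim y i, Sum.elim y i) (Sum.elim x a, Sum.elim x a') = ind (a' = a) := by
    rw [← sum_bits_sum fun z => c.eval (z, z) (Sum.elim x a, Sum.elim x a'), c.sum_eval_diag,
      ite_eq_ind, ind_bits_sum]
    simp only [Sum.elim_comp_inl, Sum.elim_comp_inr]
    rw [ind_true trivial, one_mul, ind_congr eq_comm]
  simp only [Matrix.trace, Matrix.diag, step, applyWith, Matrix.of_apply]
  calc _ = ∑ a, ∑ a', (∑ y, ∑ i, c.eval (Sum.elim y i, Sum.elim y i)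
        (Sum.elim x a, Sum.elim x a')) * ρ a a' := by
        simp_rw [Finset.sum_mul]
        rw [← Fintype.sum_prod_type' fun (y : Bits o) (i : Bits β) => ∑ a, ∑ a',
          c.eval (Sum.elim y i, Sum.elim y i) (Sum.elim x a, Sum.elim x a') * ρ a a',
          Finset.sum_comm]
        refine Finset.sum_congr rfl fun a _ => ?_
        rw [Finset.sum_comm]
        exact Finset.sum_congr rfl fun a' _ => Fintype.sum_prod_type _
    _ = _ := by
        simp_rw [h, mul_comm (ind _), sum_mul_ind]

/-- By linearity the two branches created by a coin flip can be followed separately. -/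
theorem step_add_smul [Fintype α] [DecidableEq α] (c : QCirc (ι ⊕ α) (o ⊕ β)) (x : Bits ι)
    (y : Bits o) (r s : ℂ) (ρ σ : Op α) :
    c.step x y (r • ρ + s • σ) = r • c.step x y ρ + s • c.step x y σ := by
  ext i j
  simp only [step, applyWith, Matrix.of_apply, Matrix.add_apply, Matrix.smul_apply, smul_eq_mul,
    Finset.mul_sum, ← Finset.sum_add_distrib]
  refine Finset.sum_congr rfl fun a _ => Finset.sum_congr rfl fun a' _ => ?_
  ring

theorem step_single [Fintype α] [DecidableEq α] (c : QCirc (ι ⊕ α) (o ⊕ β)) (x : Bits ι)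
    (y : Bits o) (a : Bits α) :
    c.step x y (Matrix.single a a 1) =
      Matrix.of fun i j => c.eval (Sum.elim y i, Sum.elim y j) (Sum.elim x a, Sum.elim x a) := by
  ext i j
  simp only [step, applyWith, Matrix.of_apply, single_eq_ind, sum_sum_mul_ind]

/-- The final measurement removes the off-diagonal terms, and the weight of `y` is that of its fibre
under `f`. -/
theorem eval_seq_measure [Fintype β] [DecidableEq β] (c : QCirc α β) {d : QCirc β γ}
    {f : Bits β → Bits γ} (hd : ∀ y y' x x', d.eval (y, y') (x, x') =
      ind (x = x') * (ind (y = f x) * ind (y' = f x)))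
    (y : Bits γ) (x : Bits α × Bits α) :
    (seq c d).eval (y, y) x = ∑ z, ind (f z = y) * c.eval (z, z) x := by
  rw [eval_seq]
  refine Finset.sum_congr rfl fun z _ => ?_
  have h (z' : Bits β) : d.eval (y, y) (z, z') * c.eval (z, z') x =
      ind (y = f z) * ind (y = f z) * c.eval (z, z') x * ind (z' = z) := by
    rw [hd, ind_congr (eq_comm (a := z))]
    ring
  simp_rw [h, sum_mul_ind]
  rw [← ind_and, and_self, ind_congr eq_comm]

end QCirc

/-! ### Circuits for Bob and Charlie -/

section Cloning

variable {P Ct T Sk M MB MC : Type} [Fintype MB] [DecidableEq MB] [Fintype MC] [DecidableEq MC]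

/-- The weight of the outcomes `a` for Bob and `b` for Charlie. -/
def jointOutcome (B : QCirc (Sk ⊕ MB) M) (C : QCirc (Sk ⊕ MC) M) (sk : Bits Sk)
    (σ : Op (MB ⊕ MC)) (a b : Bits M) : ℂ :=
  ∑ i, ∑ i', ∑ j, ∑ j', B.eval (a, a) (Sum.elim sk i, Sum.elim sk i') *
    C.eval (b, b) (Sum.elim sk j, Sum.elim sk j') * σ (Sum.elim i j) (Sum.elim i' j')

theorem bothGuess_eq (B : QCirc (Sk ⊕ MB) M) (C : QCirc (Sk ⊕ MC) M) (sk : Bits Sk)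
    (m : Bits M) (σ : Op (MB ⊕ MC)) :
    bothGuess B C sk m σ = (jointOutcome B C sk σ m m).re := rfl

/-- Bob and Charlie as a single circuit. -/
theorem exists_bobCharlie [Finite Sk] (B : QCirc (Sk ⊕ MB) M) (C : QCirc (Sk ⊕ MC) M) :
    ∃ c : QCirc (Sk ⊕ (MB ⊕ MC)) (M ⊕ M), c.size ≤ 2 * Nat.card Sk + (B.size + C.size) ∧
      ∀ sk σ a b, ∑ y, ∑ y', c.eval (Sum.elim a b, Sum.elim a b) (Sum.elim sk y, Sum.elim sk y') *
        σ y y' = jointOutcome B C sk σ a b := by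
  classical
  have := Fintype.ofFinite Sk
  obtain ⟨d, hd, hds⟩ := ComputableWithin.copy Sk
  -- The key is classical, so it can be copied; the registers are then regrouped so that each copy
  -- stands beside the memory of its owner.
  refine ⟨.seq (.par d (.wire (Equiv.refl (MB ⊕ MC))))
    (.seq (.wire (Equiv.sumSumSumComm Sk Sk MB MC)) (.par B C)), ?_, fun sk σ a b => ?_⟩
  · simp only [QCirc.size_seq, QCirc.size_par, QCirc.size_wire]
    omega
  · simp_rw [hd.eval_parWire_seq, QCirc.eval_wire_seq, QCirc.eval_par]
    unfold jointOutcome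
    simp_rw [sum_bits_sum (α := MB)]
    refine Finset.sum_congr rfl fun i _ => ?_
    rw [Finset.sum_comm]
    refine Finset.sum_congr rfl fun i' _ => Finset.sum_congr rfl fun j _ =>
      Finset.sum_congr rfl fun j' _ => ?_
    congr 3 <;> congr 1 <;> funext u <;> rcases u with u | u <;> rfl

/-- The circuit that tests whether Bob and Charlie both output `m`. -/
theorem exists_cloningTest [Finite Sk] [Finite M] {X : Type} [Finite X]
    (B : QCirc (Sk ⊕ MB) M) (C : QCirc (Sk ⊕ MC) M) (Q : QCirc Empty (MB ⊕ MC))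
    {g : Bits X → Bits Sk} {N : ℕ} (hg : ComputableWithin g N) (m : Bits M) :
    ∃ D : QCirc X Unit,
      D.size ≤ N + (Q.size + (2 * Nat.card Sk + (B.size + C.size) +
        (3 * (Nat.card M + Nat.card M) + ComputableWithin.eqCost (Nat.card M + Nat.card M)))) ∧
      ∀ x, D.prob x (fun _ => true) = bothGuess B C (g x) m (Q.outState Empty.elim) := by
  classical
  have := Fintype.ofFinite Sk
  have := Fintype.ofFinite M
  have := Fintype.ofFinite X
  obtain ⟨c, hcs, hc⟩ := exists_bobCharlie B C
  obtain ⟨d, hds, hd⟩ := (ComputableWithin.eq_const (Sum.elim m m)).exists_measure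
  obtain ⟨G, hG, hGs⟩ := hg
  -- Here `G` computes the key from the input, `Q` prepares the shared state, `c` runs both parties,
  -- and `d` measures and compares the two guesses with `(m, m)`.
  refine ⟨.seq (.wire (Equiv.sumEmpty X Empty).symm) (.seq (.par G (.wire (Equiv.refl Empty)))
    (.seq (.par (.wire (Equiv.refl Sk)) Q) (.seq c d))), ?_, fun x => ?_⟩
  · simp only [QCirc.size_seq, QCirc.size_par, QCirc.size_wire]
    rw [Nat.card_sum] at hds
    omega
  · have hx : x ∘ (Equiv.sumEmpty X Empty).symm.symm = Sum.elim x Empty.elim := by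
      funext u
      rcases u with u | u
      · rfl
      · exact u.elim
    rw [QCirc.prob, QCirc.eval_wire_seq, bothGuess_eq, ← hc]
    simp only [hx]
    rw [hG.eval_parWire_seq, QCirc.eval_wirePar_seq]
    have h (z : Bits (M ⊕ M)) :
        ind ((fun _ : Unit => nand (z ≠ Sum.elim m m)) = fun _ => true) =
          ind (z = Sum.elim m m) := ind_congr (by simp [bits_unit_eq_iff, nand])
    simp_rw [QCirc.eval_seq_measure c hd, h, sum_ind_mul]
    rfl

/-- The memory of an adversary that holds `σ` and the classical bit `b`. -/
def memState {α μ : Type} (e : α ⊕ Unit ≃ μ) (σ : Op α) (b : Bits Unit) : Op μ :=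
  Matrix.of fun u u' => σ (u ∘ e ∘ Sum.inl) (u' ∘ e ∘ Sum.inl) *
    (ind (u ∘ e ∘ Sum.inr = b) * ind (u' ∘ e ∘ Sum.inr = b))

/-- The circuit that runs Bob and Charlie and compares the bit in its memory with
their success. -/
theorem exists_guess [Finite Sk] [Finite M] {μ : Type} [Fintype μ] [DecidableEq μ]
    (B : QCirc (Sk ⊕ MB) M) (C : QCirc (Sk ⊕ MC) M) (e : (MB ⊕ MC) ⊕ Unit ≃ μ) (m : Bits M) :
    ∃ G : QCirc (Sk ⊕ μ) (Unit ⊕ Empty),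
      G.size ≤ (2 * Nat.card Sk + (B.size + C.size)) +
        (3 * (Nat.card M + Nat.card M + 1) +
          (ComputableWithin.eqCost (Nat.card M + Nat.card M) + 2)) ∧
      ∀ sk b σ, (G.step sk (fun _ => false) (memState e σ fun _ => b)).trace =
        if b then jointOutcome B C sk σ m m else σ.trace - jointOutcome B C sk σ m m := by
  classical
  have := Fintype.ofFinite Sk
  have := Fintype.ofFinite M
  obtain ⟨c, hcs, hc⟩ := exists_bobCharlie B C
  -- The output is the XOR of the remembered bit with the success bit. Output 0 thus means
  -- agreement: success if the bit is 1, failure if it is 0.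
  obtain ⟨d, hds, hd⟩ := (ComputableWithin.xor_bit.comp
    ((ComputableWithin.eq_const (Sum.elim m m)).par
      (ComputableWithin.wire (Equiv.refl Unit)))).exists_measure
  let G : QCirc (Sk ⊕ μ) (Unit ⊕ Empty) :=
    .seq (.wire ((Equiv.sumCongr (Equiv.refl Sk) e.symm).trans
        (Equiv.sumAssoc Sk (MB ⊕ MC) Unit).symm))
      (.seq (.seq (.par c (.wire (Equiv.refl Unit))) d)
        (.wire (Equiv.sumEmpty Unit Empty).symm))
  refine ⟨G, ?_, fun sk b σ => ?_⟩
  · simp only [G, QCirc.size_seq, QCirc.size_par, QCirc.size_wire]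
    rw [Nat.card_sum, Nat.card_sum, Nat.card_unique (α := Unit)] at hds
    omega
  · have hmem (y y' : Bits (MB ⊕ MC)) (a a' : Bits Unit) :
        memState e σ (fun _ => b) (Sum.elim y a ∘ e.symm) (Sum.elim y' a' ∘ e.symm) =
          σ y y' * (ind (a = fun _ => b) * ind (a' = fun _ => b)) := by
      have h (y : Bits (MB ⊕ MC)) (a : Bits Unit) : (Sum.elim y a ∘ e.symm) ∘ e = Sum.elim y a := by
        rw [Function.comp_assoc, Equiv.symm_comp_self, Function.comp_id]
      simp only [memState, Matrix.of_apply, ← Function.comp_assoc, h, Sum.elim_comp_inl,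
        Sum.elim_comp_inr]
    have hx (y : Bits (MB ⊕ MC)) (a : Bits Unit) : Sum.elim sk (Sum.elim y a ∘ e.symm) ∘
        ((Equiv.sumCongr (Equiv.refl Sk) e.symm).trans
          (Equiv.sumAssoc Sk (MB ⊕ MC) Unit).symm).symm = Sum.elim (Sum.elim sk y) a := by
      funext u
      rcases u with (u | u) | u <;> simp
    have hf (z : Bits (M ⊕ M)) (a : Bits Unit) :
        (((fun (x : Bits (Unit ⊕ Unit)) (_ : Unit) => xor (x (.inr ())) (x (.inl ()))) ∘
          fun x : Bits ((M ⊕ M) ⊕ Unit) => Sum.elim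
            (fun _ : Unit => nand (x ∘ Sum.inl ≠ Sum.elim m m))
            ((x ∘ Sum.inr) ∘ (Equiv.refl Unit).symm)) (Sum.elim z a)) =
          fun _ => xor (a ()) (nand (z ≠ Sum.elim m m)) := by
      funext u
      simp
    have hy (i : Bits Empty) : Sum.elim (fun _ : Unit => false) i ∘
        (Equiv.sumEmpty Unit Empty).symm = fun _ => false := rfl
    have hG (i : Bits Empty) (y y' : Bits (MB ⊕ MC)) :
        G.eval (Sum.elim (fun _ => false) i, Sum.elim (fun _ => false) i)
          (Sum.elim sk (Sum.elim y (fun _ => b) ∘ e.symm),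
            Sum.elim sk (Sum.elim y' (fun _ => b) ∘ e.symm)) =
        ∑ z, ind ((fun _ : Unit => xor b (nand (z ≠ Sum.elim m m))) = fun _ => false) *
          c.eval (z, z) (Sum.elim sk y, Sum.elim sk y') := by
      simp only [G]
      rw [QCirc.eval_wire_seq, QCirc.eval_seq_wire]
      simp only [hx, hy]
      rw [QCirc.eval_seq_measure _ hd, sum_bits_sum]
      refine Finset.sum_congr rfl fun z _ => ?_
      simp only [QCirc.eval_par, QCirc.eval_wire_eq_ind, Sum.elim_comp_inl, Sum.elim_comp_inr,
        ← mul_assoc, hf]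
      exact (sum_mul_ind _ _).trans (by rw [ind_true rfl, mul_one]; rfl)
    set J : Bits (M ⊕ M) → ℂ := fun z => ∑ y, ∑ y',
      c.eval (z, z) (Sum.elim sk y, Sum.elim sk y') * σ y y' with hJ
    have hJm : J (Sum.elim m m) = jointOutcome B C sk σ m m := hc sk σ m m
    -- The weights of all pairs of guesses add up to the trace of `σ`; the weight of failure is
    -- therefore the complement of that of success.
    have hJs : ∑ z, J z = σ.trace := by
      rw [hJ, Finset.sum_comm]
      refine Finset.sum_congr rfl fun y _ => ?_
      rw [Finset.sum_comm]
      simp_rw [← Finset.sum_mul, c.sum_eval_diag, ite_eq_ind]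
      have (y' : Bits (MB ⊕ MC)) : ind (Sum.elim sk y = Sum.elim sk y') = ind (y' = y) := by
        apply ind_congr
        rw [bits_sum_ext_iff]
        simp [eq_comm]
      simp_rw [this, sum_ind_mul]
      rfl
    have hsum : ∑ z, ind ((fun _ : Unit => xor b (nand (z ≠ Sum.elim m m))) = fun _ => false) *
        J z = if b then jointOutcome B C sk σ m m else σ.trace - jointOutcome B C sk σ m m := by
      cases b
      · have h (z : Bits (M ⊕ M)) :
            ind ((fun _ : Unit => xor false (nand (z ≠ Sum.elim m m))) = fun _ => false) =
              1 - ind (z = Sum.elim m m) := by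
          by_cases hz : z = Sum.elim m m <;> simp [ind, hz, bits_unit_eq_iff, nand]
        simp_rw [h, sub_mul, one_mul, Finset.sum_sub_distrib, sum_ind_mul, hJs, hJm]
        rfl
      · have h (z : Bits (M ⊕ M)) :
            ind ((fun _ : Unit => xor true (nand (z ≠ Sum.elim m m))) = fun _ => false) =
              ind (z = Sum.elim m m) := by
          by_cases hz : z = Sum.elim m m <;> simp [ind, hz, bits_unit_eq_iff, nand]
        simp_rw [h, sum_ind_mul, hJm]
        rfl
    rw [← hsum]
    simp only [Matrix.trace, Matrix.diag, QCirc.step, QCirc.applyWith, Matrix.of_apply]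
    rw [Fintype.sum_unique, sum_bits_equiv e]
    simp_rw [sum_bits_equiv e, sum_bits_sum (α := MB ⊕ MC)]
    simp_rw [hmem, ← mul_assoc, sum_mul_ind]
    refine (Finset.sum_congr rfl fun y _ => Finset.sum_comm).trans ?_
    simp_rw [sum_mul_ind, hG, hJ, Finset.mul_sum, Finset.sum_mul]
    refine (Finset.sum_congr rfl fun y _ => Finset.sum_comm).trans ?_
    rw [Finset.sum_comm]
    simp_rw [mul_assoc]

end Cloning

/-! ### Circuits for Alice with hardwired data -/

section Alice

variable {P Ct T β : Type} [Fintype Ct] [DecidableEq Ct] [Fintype T] [DecidableEq T]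

theorem applyWith_tagged (A : QCirc (P ⊕ (Ct ⊕ T)) β) (pk : Bits P) (c : Bits Ct) (ρ : Op T) :
    A.applyWith pk (tagged c ρ) = Matrix.of fun y y' => ∑ t, ∑ t',
      A.eval (y, y') (Sum.elim pk (Sum.elim c t), Sum.elim pk (Sum.elim c t')) * ρ t t' := by
  ext y y'
  simp only [QCirc.applyWith, Matrix.of_apply, tagged]
  simp_rw [sum_bits_sum (α := Ct), Sum.elim_comp_inl, Sum.elim_comp_inr]
  rw [Finset.sum_comm]
  refine Finset.sum_congr rfl fun t _ => ?_
  refine (Finset.sum_congr rfl fun c _ => Finset.sum_comm).trans ?_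
  simp_rw [← mul_assoc, sum_mul_ind]
  rw [Finset.sum_comm]
  simp_rw [sum_mul_ind]

/-- Alice, run with a ciphertext state that is prepared by the circuit `E`. -/
theorem exists_alice_withState [Fintype P] [DecidableEq P] (A : QCirc (P ⊕ (Ct ⊕ T)) β) (E : QCirc Empty T) :
    ∃ R : QCirc (P ⊕ Ct) β, R.size ≤ E.size + A.size ∧
      ∀ pk c, R.outState (Sum.elim pk c) =
        A.applyWith pk (tagged c (E.outState Empty.elim)) := by
  refine ⟨.seq (.wire (Equiv.sumEmpty (P ⊕ Ct) Empty).symm)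
    (.seq (.par (.wire (Equiv.refl _)) E) (.seq (.wire (Equiv.sumAssoc P Ct T)) A)), ?_,
    fun pk c => ?_⟩
  · simp only [QCirc.size_seq, QCirc.size_par, QCirc.size_wire]
    omega
  · rw [applyWith_tagged]
    ext y y'
    simp only [QCirc.outState, Matrix.of_apply]
    rw [QCirc.eval_wire_seq, QCirc.eval_wirePar_seq]
    refine Finset.sum_congr rfl fun t _ => Finset.sum_congr rfl fun t' _ => ?_
    rw [QCirc.eval_wire_seq]
    congr 2
    · congr 1 <;> funext u <;> rcases u with u | u | u <;> rfl
    · congr 1 <;> exact Subsingleton.elim _ _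

/-- Alice, run with a fixed public key and a fixed classical part of the ciphertext. -/
theorem exists_alice_withKey [Fintype P] [DecidableEq P] (A : QCirc (P ⊕ (Ct ⊕ T)) β) (pk : Bits P) (c : Bits Ct) :
    ∃ R : QCirc T β, R.size ≤ 2 * (Nat.card P + Nat.card Ct) + A.size ∧
      ∀ ρ, R.apply ρ = A.applyWith pk (tagged c ρ) := by
  obtain ⟨K, hK, hKs⟩ := QCirc.exists_const (Sum.elim pk c)
  rw [Nat.card_sum] at hKs
  refine ⟨.seq (.wire (Equiv.emptySum Empty T).symm)
    (.seq (.par K (.wire (Equiv.refl _))) (.seq (.wire (Equiv.sumAssoc P Ct T)) A)), ?_,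
    fun ρ => ?_⟩
  · simp only [QCirc.size_seq, QCirc.size_par, QCirc.size_wire]
    omega
  · rw [applyWith_tagged]
    ext y y'
    simp only [QCirc.apply, Matrix.of_apply]
    refine Finset.sum_congr rfl fun t _ => Finset.sum_congr rfl fun t' _ => ?_
    have h (t : Bits T) : t ∘ (Equiv.emptySum Empty T).symm.symm = Sum.elim Empty.elim t := by
      funext u
      rcases u with u | u
      · exact u.elim
      · rfl
    rw [QCirc.eval_wire_seq]
    simp only [h]
    rw [hK.eval_parWire_seq, QCirc.eval_wire_seq]
    congr 2
    congr 1 <;> funext u <;> rcases u with u | u | u <;> rfl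

end Alice

/-- Bob and Charlie, run with a key that is computed from another key. -/
theorem exists_guess_withKey {K Sk M MB MC : Type} [Finite Sk] [Fintype MB]
    [DecidableEq MB] [Fintype MC] [DecidableEq MC] (B : QCirc (Sk ⊕ MB) M)
    (C : QCirc (Sk ⊕ MC) M) {g : Bits K → Bits Sk} {N : ℕ} (hg : ComputableWithin g N) :
    ∃ (B' : QCirc (K ⊕ MB) M) (C' : QCirc (K ⊕ MC) M), B'.size ≤ N + B.size ∧
      C'.size ≤ N + C.size ∧
      ∀ k m σ, bothGuess B' C' k m σ = bothGuess B C (g k) m σ := by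
  classical
  have := Fintype.ofFinite Sk
  obtain ⟨G, hG, hGs⟩ := hg
  -- Each party runs the same circuit `G` on the key it receives. As `G` computes a function, both
  -- obtain the same derived key.
  refine ⟨.seq (.par G (.wire (Equiv.refl MB))) B, .seq (.par G (.wire (Equiv.refl MC))) C,
    ?_, ?_, fun k m σ => ?_⟩
  · simp only [QCirc.size_seq, QCirc.size_par, QCirc.size_wire]
    omega
  · simp only [QCirc.size_seq, QCirc.size_par, QCirc.size_wire]
    omega
  · simp only [bothGuess, hG.eval_parWire_seq]

/-! ### The first two moves of the adversary against functional encryption -/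

section Messages

variable {P Ct I CI α μ ν : Type} [Fintype P] [DecidableEq P] [Fintype μ]

/-- The circuit that flips a coin, sends one of two messages, and remembers its input and
the coin. -/
theorem exists_chooseMsg [Fintype I] (e : P ⊕ Unit ≃ μ) (x₀ x₁ : Bits I) :
    ∃ K : QCirc (P ⊕ Empty) (I ⊕ μ),
      K.size ≤ 5 + ((Nat.card I + Nat.card μ) * (2 * (Nat.card P + 1) + (Nat.card P + 1 + 2)) +
        (Nat.card P + 1)) ∧
      ∀ pk x, K.step pk x 1 =
        (ind (x = x₁) / 2) • Matrix.single (Sum.elim pk (fun _ => true) ∘ e.symm)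
          (Sum.elim pk (fun _ => true) ∘ e.symm) 1 +
        (ind (x = x₀) / 2) • Matrix.single (Sum.elim pk (fun _ => false) ∘ e.symm)
          (Sum.elim pk (fun _ => false) ∘ e.symm) 1 := by
  -- The memory keeps the public key, since Alice is run only after the ciphertext has arrived, and
  -- the coin, which is compared with the outcome at the end.
  let f : Bits (P ⊕ Unit) → Bits (I ⊕ μ) := fun z =>
    Sum.elim (fun i => cond (z (.inr ())) (x₁ i) (x₀ i)) (z ∘ e.symm)
  have hf : ComputableWithin f ((Nat.card I + Nat.card μ) *
      (2 * (Nat.card P + 1) + (Nat.card P + 1 + 2)) + (Nat.card P + 1)) := by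
    have h : Nat.card (P ⊕ Unit) = Nat.card P + 1 := by
      rw [Nat.card_sum, Nat.card_unique (α := Unit)]
    rw [← Nat.card_sum, ← h]
    refine ComputableWithin.pi fun j => ?_
    rcases j with i | u
    · exact ComputableWithin.of_bit (Sum.inr ()) fun b => cond b (x₁ i) (x₀ i)
    · exact ComputableWithin.of_bit (e.symm u) fun b => b
  obtain ⟨c, hcs, hc⟩ := QCirc.exists_coin
  obtain ⟨F, hF, hFs⟩ := hf
  refine ⟨.seq (.par (.wire (Equiv.refl P)) c) F, ?_, fun pk x => ?_⟩
  · simp only [QCirc.size_seq, QCirc.size_par, QCirc.size_wire]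
    omega
  · ext i j
    simp only [QCirc.step, QCirc.applyWith, Matrix.of_apply, Matrix.add_apply, Matrix.smul_apply,
      smul_eq_mul, single_eq_ind]
    rw [Fintype.sum_unique, Fintype.sum_unique, Matrix.one_apply_eq, mul_one,
      QCirc.eval_wirePar_seq]
    -- The coin has no coherences, so just two diagonal branches of weight 1/2 remain.
    have hc' (y y' : Bits Unit) (u) : c.eval (y, y') u = 1 / 2 * ind (y' = y) := by
      rw [hc, ind_congr eq_comm, mul_comm]
    simp only [hc', ← mul_assoc, sum_mul_ind, Sum.elim_comp_inl]
    have hFf (b : Bool) : F.eval (Sum.elim x i, Sum.elim x j)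
        (Sum.elim pk (fun _ => b), Sum.elim pk (fun _ => b)) =
        ind (x = cond b x₁ x₀) * ind (i = Sum.elim pk (fun _ => b) ∘ e.symm) *
          ind (j = Sum.elim pk (fun _ => b) ∘ e.symm) := by
      rw [hF, ind_bits_sum (Sum.elim x i), ind_bits_sum (Sum.elim x j)]
      simp only [Sum.elim_comp_inl, Sum.elim_comp_inr, f, Sum.elim_inr]
      have : (fun i => cond b (x₁ i) (x₀ i)) = cond b x₁ x₀ := by
        cases b <;> rfl
      rw [this]
      by_cases hx : x = cond b x₁ x₀
      · rw [ind_true hx]; ring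
      · rw [ind_false hx]; ring
    rw [sum_bits_unit, hFf, hFf]
    simp only [cond_true, cond_false]
    ring

/-- The circuit that runs `R` on the remembered input and the challenge, and sends the
fixed string `C₀`. -/
theorem exists_chooseCirc [Fintype Ct] [DecidableEq Ct] [Fintype CI] [DecidableEq CI]
    [Fintype α] [DecidableEq α] [DecidableEq μ] (e : P ⊕ Unit ≃ μ) (e' : α ⊕ Unit ≃ ν) (R : QCirc (P ⊕ Ct) α)
    (C₀ : Bits CI) :
    ∃ K : QCirc (Ct ⊕ μ) (CI ⊕ ν), K.size ≤ 2 * Nat.card CI + R.size ∧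
      ∀ ct C pk b, K.step ct C (Matrix.single (Sum.elim pk (fun _ => b) ∘ e.symm)
          (Sum.elim pk (fun _ => b) ∘ e.symm) 1) =
        ind (C = C₀) • memState e' (R.outState (Sum.elim pk ct)) fun _ => b := by
  obtain ⟨K, hK, hKs⟩ := QCirc.exists_const C₀
  -- The regrouping takes `(ct, (pk, b))` to `(∅, ((pk, ct), b))`; on the empty register the
  -- constant `C₀` is prepared.
  let w : Ct ⊕ μ ≃ Empty ⊕ ((P ⊕ Ct) ⊕ Unit) :=
    (Equiv.sumCongr (Equiv.refl Ct) e.symm).trans ((Equiv.sumAssoc Ct P Unit).symm.trans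
      ((Equiv.sumCongr (Equiv.sumComm Ct P) (Equiv.refl Unit)).trans
        (Equiv.emptySum Empty _).symm))
  refine ⟨.seq (.wire w) (.seq (.par K (.par R (.wire (Equiv.refl Unit))))
    (.wire (Equiv.sumCongr (Equiv.refl CI) e'))), ?_, fun ct C pk b => ?_⟩
  · simp only [QCirc.size_seq, QCirc.size_par, QCirc.size_wire]
    omega
  · have hw : Sum.elim ct (Sum.elim pk (fun _ => b) ∘ e.symm) ∘ w.symm =
        Sum.elim Empty.elim (Sum.elim (Sum.elim pk ct) fun _ => b) := by
      funext u
      rcases u with u | (u | u) | u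
      · exact u.elim
      all_goals simp [w]
    have hv (u : Bits ν) : Sum.elim C u ∘ Equiv.sumCongr (Equiv.refl CI) e' =
        Sum.elim C (Sum.elim (u ∘ e' ∘ Sum.inl) (u ∘ e' ∘ Sum.inr)) := by
      funext v
      rcases v with v | v | v <;> rfl
    rw [QCirc.step_single]
    ext i j
    simp only [Matrix.of_apply, Matrix.smul_apply, memState, smul_eq_mul, QCirc.outState]
    rw [QCirc.eval_wire_seq, QCirc.eval_seq_wire]
    simp only [hw, hv]
    rw [QCirc.eval_par, QCirc.eval_par]
    simp only [Sum.elim_comp_inl, Sum.elim_comp_inr, QCirc.eval_wire_eq_ind]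
    rw [hK, ← ind_and, and_self]
    rfl

end Messages

/-! ### The reductions -/

/-- Every bit of the description of `F[ct]` is constant or a bit of `ct`. -/
theorem trojan_bit {κ c d u : ℕ} (D : BCirc (Fin κ ⊕ Fin c) d (Fin u))
    (p : (Fin (trojanSize c d u) ⊕ Fin u) × (TrojanIn κ u ⊕ Fin (trojanSize c d u))) :
    (∃ i, ∀ ct, trojan D ct p = ct i) ∨ ∃ b, ∀ ct, trojan D ct p = b := by
  obtain ⟨a, ha⟩ : ∃ a : TrojanGate c d u ⊕ Fin u, a.map TrojanGate.pos id = p.1 :=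
    (Sum.map_surjective.2 ⟨TrojanGate.pos_surjective, Function.surjective_id⟩) p.1
  obtain ⟨b, hb⟩ : ∃ b : TrojanIn κ u ⊕ TrojanGate c d u, b.map id TrojanGate.pos = p.2 :=
    (Sum.map_surjective.2 ⟨Function.surjective_id, TrojanGate.pos_surjective⟩) p.2
  obtain rfl : (a.map TrojanGate.pos id, b.map id TrojanGate.pos) = p := Prod.ext ha hb
  -- A hardwired bit is encoded by the wire from the constant 0 to its gate: with it the NAND is 1,
  -- without it the empty NAND is 0. These are the only entries of the table that depend on `ct`.
  by_cases h : ∃ i, a = .inl (.ctBit i) ∧ b = .inr .zero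
  · obtain ⟨i, rfl, rfl⟩ := h
    refine Or.inl ⟨i, fun ct => ?_⟩
    rw [Bool.eq_iff_iff, trojan_apply]
    constructor
    · intro hw
      cases hw
      assumption
    · exact TrojanWire.ctBit i
  · have hw (ct ct') (hw : TrojanWire D ct a b) : TrojanWire D ct' a b := by
      cases hw with
      | ctBit i hi => exact absurd ⟨i, rfl, rfl⟩ h
      | _ => constructor <;> assumption
    refine Or.inr ⟨trojan D (fun _ => false) (a.map TrojanGate.pos id, b.map id TrojanGate.pos), fun ct => ?_⟩
    rw [Bool.eq_iff_iff, trojan_apply, trojan_apply]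
    exact ⟨hw _ _, hw _ _⟩

namespace SKEScheme

variable {msgLen : ℕ → ℕ} (S : SKEScheme msgLen)

/-- These registers are inputs and outputs of the encryption circuits, whose lengths are
polynomially bounded by assumption. -/
theorem card_enc_poly : PolyBounded S.keyLen ∧ PolyBounded msgLen ∧ PolyBounded S.ctLen := by
  obtain ⟨-, -, -, h₁, h₂⟩ := S.enc_poly.computableWithin (j := fun n => n) PolyBounded.id
  simp only [Fintype.card_sum, Fintype.card_fin] at h₁ h₂
  exact ⟨h₁.mono fun n => by omega, h₁.mono fun n => by omega, h₂⟩

/-- Encryption with a fixed key and fixed coins is computable. -/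
theorem enc_computable : ∃ N : ℕ → ℕ, PolyBounded N ∧ ∀ n K r,
    ComputableWithin (fun x => S.enc n (Sum.elim K (Sum.elim x r))) (N n) := by
  obtain ⟨N, hN, hc, h₁, -⟩ := S.enc_poly.computableWithin (j := fun n => n) PolyBounded.id
  have hm := S.card_enc_poly.2.1
  refine ⟨_, ((h₁.mul (((PolyBounded.const 2).mul hm).add (hm.add (PolyBounded.const 2)))).add
    hm).add hN, fun n K r => ?_⟩
  have h : ComputableWithin (fun x : Bits (Fin (msgLen n)) => Sum.elim K (Sum.elim x r)) _ :=
    ComputableWithin.pi (N := Nat.card (Fin (msgLen n)) + 2) fun j => by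
      rcases j with j | j | j
      · exact ComputableWithin.const_bit (K j)
      · exact ComputableWithin.of_bit j fun b => b
      · exact ComputableWithin.const_bit (r j)
  rw [Nat.card_eq_fintype_card, Nat.card_fin] at h
  exact (hc n).comp h

/-- Expectations over keys and ciphertexts commute with averages. -/
theorem expect_avg {ω : Type} [Fintype ω] [DecidableEq ω] (n : ℕ) (x : Bits (Fin (msgLen n)))
    (f : Bits (Fin (S.keyLen n)) → Bits (Fin (S.ctLen n)) → Bits ω → ℝ) :
    (S.expect n x fun K c => avg (f K c)) = avg fun z => S.expect n x fun K c => f K c z := by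
  unfold expect
  refine (congrArg avg (funext fun r => avg_comm fun r' z =>
    f (S.setup n r) (S.enc n (Sum.elim (S.setup n r) (Sum.elim x r'))) z)).trans ?_
  exact avg_comm fun r z => avg fun r' =>
    f (S.setup n r) (S.enc n (Sum.elim (S.setup n r) (Sum.elim x r'))) z

end SKEScheme

/-! ### The cloning experiment as a circuit, and the pseudorandomness step -/

section Scheme

variable (UE : UEScheme) (SKE : SKEScheme UE.keyLen)
  (FE : FEScheme (fun n => TrojanIn (SKE.keyLen n) (UE.keyLen n)) (fun n => Fin (UE.keyLen n)))

theorem pbkueSize_poly : PolyBounded (pbkueSize UE SKE) := by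
  have h := SKE.card_enc_poly
  exact (((PolyBounded.const 2).add h.2.2).add SKE.dec_poly).add
    ((PolyBounded.const 3).mul h.2.1)

theorem id_add_pbkueSize_poly : PolyBounded fun n => n + pbkueSize UE SKE n :=
  PolyBounded.id.add (pbkueSize_poly UE SKE)

theorem FE_len_poly : PolyBounded (fun n => FE.mpkLen n (pbkueSize UE SKE n)) ∧
    PolyBounded (fun n => FE.ctLen n (pbkueSize UE SKE n)) ∧
    PolyBounded (fun n => FE.skLen n (pbkueSize UE SKE n)) := by
  have hs := id_add_pbkueSize_poly UE SKE
  obtain ⟨-, -, -, -, h₁⟩ :=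
    FE.setup_poly.computableWithin (j := fun n => (n, pbkueSize UE SKE n)) hs
  obtain ⟨-, -, -, -, h₂⟩ :=
    FE.enc_poly.computableWithin (j := fun n => (n, pbkueSize UE SKE n)) hs
  obtain ⟨-, -, -, -, h₃⟩ :=
    FE.keyGen_poly.computableWithin (j := fun n => (n, pbkueSize UE SKE n)) hs
  simp only [Fintype.card_sum, Fintype.card_fin] at h₁ h₂ h₃
  exact ⟨h₁.mono fun n => by omega, h₂, h₃⟩

/-- The functional key of `F[ct]` is computable from `ct`. -/
theorem trojanKey_computable : ∃ N : ℕ → ℕ, PolyBounded N ∧ ∀ n msk r,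
    ComputableWithin (fun ct => FE.funKey n (pbkueSize UE SKE n) msk (trojan (SKE.dec n) ct) r)
      (N n) := by
  obtain ⟨N, hN, hc, h₁, -⟩ := FE.keyGen_poly.computableWithin
    (j := fun n => (n, pbkueSize UE SKE n)) (id_add_pbkueSize_poly UE SKE)
  have hm := SKE.card_enc_poly.2.2
  refine ⟨_, ((h₁.mul (((PolyBounded.const 2).mul hm).add (hm.add (PolyBounded.const 2)))).add
    hm).add hN, fun n msk r => ?_⟩
  have h : ComputableWithin (fun ct : Bits (Fin (SKE.ctLen n)) =>
      Sum.elim msk (Sum.elim (trojan (SKE.dec n) ct) r)) _ :=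
    ComputableWithin.pi (N := Nat.card (Fin (SKE.ctLen n)) + 2) fun j => by
      rcases j with j | j | j
      · exact ComputableWithin.const_bit (msk j)
      · rcases trojan_bit (SKE.dec n) j with ⟨i, hi⟩ | ⟨b, hb⟩
        · simp only [Sum.elim_inr, Sum.elim_inl, hi]
          exact ComputableWithin.of_bit i fun b => b
        · simp only [Sum.elim_inr, Sum.elim_inl, hb]
          exact ComputableWithin.const_bit b
      · exact ComputableWithin.const_bit (r j)
  rw [Nat.card_eq_fintype_card, Nat.card_fin] at h
  exact (hc n).comp h

/-- Cloning adversaries against the public-key scheme. -/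
abbrev PBKUEAdversary :=
  CloningAdversary
    (fun n => Fin (FE.mpkLen n (pbkueSize UE SKE n)) ⊕
      (Fin (FE.ctLen n (pbkueSize UE SKE n)) ⊕ Fin (UE.ctLen n)))
    (fun n => Fin (FE.skLen n (pbkueSize UE SKE n))) (fun n => Fin (UE.msgLen n))

variable {UE SKE FE}

/-- The winning probability for fixed keys, message and classical part of the ciphertext. -/
def cloneProb (𝒜 : PBKUEAdversary UE SKE FE) (n : ℕ)
    (pk : Bits (Fin (FE.mpkLen n (pbkueSize UE SKE n))))
    (c : Bits (Fin (FE.ctLen n (pbkueSize UE SKE n)))) (k : Bits (Fin (UE.keyLen n)))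
    (m : Bits (Fin (UE.msgLen n))) (sk : Bits (Fin (FE.skLen n (pbkueSize UE SKE n)))) : ℝ :=
  bothGuess (𝒜.bob n) (𝒜.charlie n) sk m
    ((𝒜.alice n).applyWith pk (tagged c (UE.encState n k m)))

/-- The honest ciphertext can be prepared, and Alice run on it. -/
theorem exists_alice_outState (𝒜 : PBKUEAdversary UE SKE FE) :
    ∃ N : ℕ → ℕ, PolyBounded N ∧ ∀ n k m,
      ∃ R : QCirc (Fin (FE.mpkLen n (pbkueSize UE SKE n)) ⊕
        Fin (FE.ctLen n (pbkueSize UE SKE n))) (Fin (𝒜.memB n) ⊕ Fin (𝒜.memC n)),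
        R.size ≤ N n ∧ ∀ pk c, R.outState (Sum.elim pk c) =
          (𝒜.alice n).applyWith pk (tagged c (UE.encState n k m)) := by
  -- The bound is chosen before `k` and `m`. They can therefore be hardwired as worst cases for each
  -- security parameter without losing polynomial size.
  refine ⟨_, ((((PolyBounded.const 2).mul (SKE.card_enc_poly.2.1.add UE.msgLen_poly)).add
    UE.enc_qpt).add 𝒜.alice_qpt), fun n k m => ?_⟩
  obtain ⟨K, hK, hKs⟩ := QCirc.exists_const (Sum.elim k m)
  obtain ⟨R, hRs, hR⟩ := exists_alice_withState (𝒜.alice n) (.seq K (UE.enc n))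
  refine ⟨R, ?_, fun pk c => ?_⟩
  · simp only [QCirc.size_seq, Nat.card_sum, Nat.card_fin] at hRs hKs
    omega
  · rw [hR]
    congr 2
    ext i j
    simp only [QCirc.outState, Matrix.of_apply, UEScheme.encState]
    rw [hK.eval_seq]

/-- The cost of the comparison of the two guesses is polynomial. -/
theorem eqCost_poly {f : ℕ → ℕ} (hf : PolyBounded f) :
    PolyBounded fun n => ComputableWithin.eqCost (f n) := by
  unfold ComputableWithin.eqCost
  exact (((hf.mul (((PolyBounded.const 3).mul hf).add (PolyBounded.const 2))).add hf).add
    (((hf.mul (((PolyBounded.const 3).mul hf).add (PolyBounded.const 4))).add hf).add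
      (PolyBounded.const 3))).add (PolyBounded.const 1)

/-- The cloning experiment as a circuit whose input determines the secret key. -/
theorem exists_cloneProb_circuit (𝒜 : PBKUEAdversary UE SKE FE) {X : ℕ → Type}
    [∀ n, Finite (X n)] {N : ℕ → ℕ} (hN : PolyBounded N) :
    ∃ N' : ℕ → ℕ, PolyBounded N' ∧ ∀ n pk c k m
      (g : Bits (X n) → Bits (Fin (FE.skLen n (pbkueSize UE SKE n)))),
      ComputableWithin g (N n) → ∃ D : QCirc (X n) Unit, D.size ≤ N' n ∧
        ∀ x, D.prob x (fun _ => true) = cloneProb 𝒜 n pk c k m (g x) := by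
  obtain ⟨NR, hNR, hR⟩ := exists_alice_outState 𝒜
  obtain ⟨hp, hc, hsk⟩ := FE_len_poly UE SKE FE
  have hm := UE.msgLen_poly
  refine ⟨_, hN.add ((((PolyBounded.const 2).mul (hp.add hc)).add hNR).add
    ((((PolyBounded.const 2).mul hsk).add (𝒜.bob_qpt.add 𝒜.charlie_qpt)).add
      (((PolyBounded.const 3).mul (hm.add hm)).add (eqCost_poly (hm.add hm))))),
    fun n pk c k m g hg => ?_⟩
  obtain ⟨R, hRs, hR⟩ := hR n k m
  obtain ⟨K, hK, hKs⟩ := QCirc.exists_const (Sum.elim pk c)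
  obtain ⟨D, hDs, hD⟩ := exists_cloningTest (𝒜.bob n) (𝒜.charlie n) (.seq K R) hg m
  refine ⟨D, ?_, fun x => ?_⟩
  · simp only [QCirc.size_seq, Nat.card_sum, Nat.card_fin] at hDs hKs
    omega
  · rw [hD, cloneProb, ← hR]
    congr 1
    ext i j
    simp only [QCirc.outState, Matrix.of_apply]
    rw [hK.eval_seq]

/-- With all classical data prepared as constants, the experiment is the acceptance probability of a
single circuit. -/
theorem cloneProb_mem (𝒜 : PBKUEAdversary UE SKE FE) (n : ℕ) (pk c k m sk) :
    0 ≤ cloneProb 𝒜 n pk c k m sk ∧ cloneProb 𝒜 n pk c k m sk ≤ 1 := by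
  obtain ⟨R, -, hR⟩ := (exists_alice_outState 𝒜).choose_spec.2 n k m
  obtain ⟨K, hK, -⟩ := QCirc.exists_const (Sum.elim pk c)
  obtain ⟨D, -, hD⟩ := exists_cloningTest (𝒜.bob n) (𝒜.charlie n) (.seq K R)
    (ComputableWithin.const (α := Empty) sk) m
  have h : cloneProb 𝒜 n pk c k m sk = D.prob Empty.elim fun _ => true := by
    rw [hD, cloneProb, ← hR]
    congr 1
    ext i j
    simp only [QCirc.outState, Matrix.of_apply]
    rw [hK.eval_seq]
  rw [h]
  exact ⟨D.prob_nonneg _ _, D.prob_le_one _ _⟩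

/-- The hardwired string can be replaced by an encryption of the key. -/
theorem negligible_pseudorandom (hPR : SKE.PseudorandomCiphertexts)
    (𝒜 : PBKUEAdversary UE SKE FE)
    (k : ∀ n, Bits (Fin (UE.keyLen n))) (m : ∀ n, Bits (Fin (UE.msgLen n)))
    (pk : ∀ n, Bits (Fin (FE.mpkLen n (pbkueSize UE SKE n))))
    (c : ∀ n, Bits (Fin (FE.ctLen n (pbkueSize UE SKE n))))
    (msk : ∀ n, Bits (Fin (FE.mskLen n (pbkueSize UE SKE n))))
    (r : ∀ n, Bits (Fin (FE.keyGenCoins n (pbkueSize UE SKE n)))) :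
    Negligible fun n =>
      |SKE.expect n (k n) (fun _ ct => cloneProb 𝒜 n (pk n) (c n) (k n) (m n)
          (FE.funKey n (pbkueSize UE SKE n) (msk n) (trojan (SKE.dec n) ct) (r n))) -
        avg fun ct => cloneProb 𝒜 n (pk n) (c n) (k n) (m n)
          (FE.funKey n (pbkueSize UE SKE n) (msk n) (trojan (SKE.dec n) ct) (r n))| := by
  obtain ⟨N, hN, hg⟩ := trojanKey_computable UE SKE FE
  obtain ⟨N', hN', hD⟩ := exists_cloneProb_circuit 𝒜 (X := fun n => Fin (SKE.ctLen n)) hN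
  -- The distinguisher receives `ct`, forms the functional key of `F[ct]` with the hardwired master
  -- secret key and coins, and accepts if the hardwired cloning attack succeeds.
  choose D hDs hD using fun n => hD n (pk n) (c n) (k n) (m n) _ (hg n (msk n) (r n))
  have h := hPR k D (hN'.mono hDs)
  simpa only [hD] using h

end Scheme

theorem ind_eq_ofReal (p : Prop) : ind p = ((ind p).re : ℂ) := by
  by_cases h : p <;> simp [ind, h]

theorem sum_ind_re_mul {ι : Type} [Fintype ι] (a : ι) (f : ι → ℝ) :
    ∑ i, (ind (i = a)).re * f i = f a := by
  classical
  simp [ind, apply_ite Complex.re]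

namespace FEScheme

variable {In Out : ℕ → Type} [∀ n, Fintype (In n)] [∀ n, Fintype (Out n)]

/-- For a fixed query and value the simulator's messages form a probability distribution: trace
preservation is applied to the three moves in turn, starting from the trivial state. -/
theorem Simulator.sum_prob {FE : FEScheme In Out} {s : ℕ → ℕ} (S : FE.Simulator s) (n : ℕ)
    (C : BCirc (In n) (s n) (Out n)) (y : Bits (Out n)) :
    ∑ mpk, ∑ ct, ∑ sk, S.prob n mpk ct C y sk = 1 := by
  simp only [Simulator.prob, ← Complex.re_sum, QCirc.sum_trace_step]
  rw [Matrix.trace_one]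
  simp

end FEScheme

/-! ### Switching the plaintext of functional encryption -/

section Scheme

variable {UE : UEScheme} {SKE : SKEScheme UE.keyLen}
  {FE : FEScheme (fun n => TrojanIn (SKE.keyLen n) (UE.keyLen n)) (fun n => Fin (UE.keyLen n))}

variable (UE SKE FE) in
/-- The winning probability when `FE` encrypts `x` and gives out a key of `C`. -/
def switchProb (𝒜 : PBKUEAdversary UE SKE FE) (n : ℕ) (k : Bits (Fin (UE.keyLen n)))
    (m : Bits (Fin (UE.msgLen n))) (x : Bits (TrojanIn (SKE.keyLen n) (UE.keyLen n)))
    (C : BCirc (TrojanIn (SKE.keyLen n) (UE.keyLen n)) (pbkueSize UE SKE n)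
      (Fin (UE.keyLen n))) : ℝ :=
  avg fun r => avg fun r₁ => avg fun r₂ =>
    cloneProb 𝒜 n (FE.mpk n _ r) (FE.encrypt n _ (FE.mpk n _ r) x r₁) k m
      (FE.funKey n _ (FE.msk n _ r) C r₂)

open Classical in
/-- The encrypted message can be replaced by any message on which the circuit has the
same value. -/
theorem negligible_switch (hFE : FE.Secure) (𝒜 : PBKUEAdversary UE SKE FE)
    (k : ∀ n, Bits (Fin (UE.keyLen n))) (m : ∀ n, Bits (Fin (UE.msgLen n)))
    (x₀ x₁ : ∀ n, Bits (TrojanIn (SKE.keyLen n) (UE.keyLen n)))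
    (C₀ : ∀ n, BCirc (TrojanIn (SKE.keyLen n) (UE.keyLen n)) (pbkueSize UE SKE n)
      (Fin (UE.keyLen n))) :
    Negligible fun n => if (C₀ n).eval (x₀ n) = (C₀ n).eval (x₁ n) then
      |switchProb UE SKE FE 𝒜 n (k n) (m n) (x₁ n) (C₀ n) -
        switchProb UE SKE FE 𝒜 n (k n) (m n) (x₀ n) (C₀ n)| else 0 := by
  let e (n : ℕ) : Fin (FE.mpkLen n (pbkueSize UE SKE n)) ⊕ Unit ≃
      Fin (FE.mpkLen n (pbkueSize UE SKE n) + 1) :=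
    (Equiv.sumCongr (Equiv.refl _) (Equiv.ofUnique Unit (Fin 1))).trans finSumFinEquiv
  let e' (n : ℕ) : (Fin (𝒜.memB n) ⊕ Fin (𝒜.memC n)) ⊕ Unit ≃ Fin (𝒜.memB n + 𝒜.memC n + 1) :=
    (Equiv.sumCongr finSumFinEquiv (Equiv.ofUnique Unit (Fin 1))).trans finSumFinEquiv
  obtain ⟨NR, hNR, hR⟩ := exists_alice_outState 𝒜
  choose R hRs hR using fun n => hR n (k n) (m n)
  choose K₁ hK₁s hK₁ using fun n => exists_chooseMsg (e n) (x₀ n) (x₁ n)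
  choose K₂ hK₂s hK₂ using fun n => exists_chooseCirc (e n) (e' n) (R n) (C₀ n)
  choose K₃ hK₃s hK₃ using fun n => exists_guess (𝒜.bob n) (𝒜.charlie n) (e' n) (m n)
  obtain ⟨hp, hc, hsk⟩ := FE_len_poly UE SKE FE
  obtain ⟨hκ, hu, -⟩ := SKE.card_enc_poly
  have hs := pbkueSize_poly UE SKE
  have hm := UE.msgLen_poly
  have h1 := PolyBounded.const 1
  have h2 := PolyBounded.const 2
  have hIn : PolyBounded fun n => 1 + (SKE.keyLen n + UE.keyLen n) := h1.add (hκ.add hu)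
  -- One adversary covers both plaintexts, with coin value 1 for `x₁` and 0 for `x₀`, so that both
  -- are compared with the same simulator.
  let A : FE.Adversary :=
    { circSize := pbkueSize UE SKE
      mem₁ := fun n => FE.mpkLen n (pbkueSize UE SKE n) + 1
      mem₂ := fun n => 𝒜.memB n + 𝒜.memC n + 1
      chooseMsg := K₁
      chooseCirc := K₂
      guess := K₃
      circSize_poly := hs
      chooseMsg_qpt := by
        refine ((PolyBounded.const 5).add (((hIn.add (hp.add h1)).mul ((h2.mul (hp.add h1)).add
          ((hp.add h1).add h2))).add (hp.add h1))).mono fun n => (hK₁s n).trans (le_of_eq ?_)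
        simp only [Nat.card_sum, Nat.card_fin, Nat.card_unique]
      chooseCirc_qpt := by
        refine ((h2.mul ((hs.add hu).mul (hIn.add hs))).add hNR).mono fun n =>
          (hK₂s n).trans ?_
        simp only [Nat.card_prod, Nat.card_sum, Nat.card_fin, Nat.card_unique]
        exact add_le_add le_rfl (hRs n)
      guess_qpt := by
        refine (((h2.mul hsk).add (𝒜.bob_qpt.add 𝒜.charlie_qpt)).add
          (((PolyBounded.const 3).mul ((hm.add hm).add h1)).add
            ((eqCost_poly (hm.add hm)).add h2))).mono fun n => (hK₃s n).trans (le_of_eq ?_)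
        simp only [Nat.card_fin] }
  have hprob (n : ℕ) (pk x ct C sk) : A.prob n pk x ct C sk =
      (ind (x = x₁ n)).re * ((ind (C = C₀ n)).re * (1 / 2 * cloneProb 𝒜 n pk ct (k n) (m n) sk)) +
      (ind (x = x₀ n)).re *
        ((ind (C = C₀ n)).re * (1 / 2 * (1 - cloneProb 𝒜 n pk ct (k n) (m n) sk))) := by
    have hclone : cloneProb 𝒜 n pk ct (k n) (m n) sk = (jointOutcome (𝒜.bob n) (𝒜.charlie n) sk
        ((R n).outState (Sum.elim pk ct)) (m n) (m n)).re := by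
      rw [hR]; rfl
    simp only [FEScheme.Adversary.prob, A]
    rw [hK₁, QCirc.step_add_smul, hK₂, hK₂, smul_smul, smul_smul, QCirc.step_add_smul,
      Matrix.trace_add, Matrix.trace_smul, Matrix.trace_smul, hK₃, hK₃, QCirc.trace_outState,
      hclone, ind_eq_ofReal (x = x₁ n), ind_eq_ofReal (x = x₀ n), ind_eq_ofReal (C = C₀ n)]
    simp only [if_true, Bool.false_eq_true, if_false, smul_eq_mul, Complex.add_re]
    have h (a b : ℝ) (z : ℂ) : (((a : ℂ) / 2 * (b : ℂ)) * z).re = a * (b * (1 / 2 * z.re)) := by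
      have : ((a : ℂ) / 2 * (b : ℂ)) = ((a / 2 * b : ℝ) : ℂ) := by push_cast; rfl
      rw [this, Complex.re_ofReal_mul]
      ring
    rw [h, h, Complex.sub_re, Complex.one_re]
    simp only [Complex.ofReal_re]
  obtain ⟨S, hS⟩ := hFE A
  -- The real probability is 1/2 plus half the gap of the two plaintexts, hence the factor 2.
  refine (hS.const_mul 2).of_abs_le fun n => ?_
  have hreal : FE.realProb A n = switchProb UE SKE FE 𝒜 n (k n) (m n) (x₁ n) (C₀ n) / 2 +
      (1 - switchProb UE SKE FE 𝒜 n (k n) (m n) (x₀ n) (C₀ n)) / 2 := by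
    unfold FEScheme.realProb
    simp_rw [hprob, avg_add, avg_const_mul, Finset.sum_add_distrib, ← Finset.mul_sum,
      sum_ind_re_mul]
    simp_rw [avg_add, avg_const_mul, Finset.sum_add_distrib, sum_ind_re_mul, avg_add,
      avg_const_mul, avg_sub, avg_const]
    change 1 / 2 * switchProb UE SKE FE 𝒜 n (k n) (m n) (x₁ n) (C₀ n) +
      1 / 2 * (1 - switchProb UE SKE FE 𝒜 n (k n) (m n) (x₀ n) (C₀ n)) = _
    ring
  -- The simulator is given only `C₀` and the common value, so its messages have the same
  -- distribution in both branches. Success in one branch and failure in the other then add up to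
  -- total weight 1/2.
  have hsim (h : (C₀ n).eval (x₀ n) = (C₀ n).eval (x₁ n)) : FE.simProb A S n = 1 / 2 := by
    have hterm (mpk x ct C sk) : S.prob n mpk ct C (BCirc.eval C x) sk * A.prob n mpk x ct C sk =
        (ind (x = x₁ n)).re * ((ind (C = C₀ n)).re * (S.prob n mpk ct C (BCirc.eval C x) sk *
          (1 / 2 * cloneProb 𝒜 n mpk ct (k n) (m n) sk))) +
        (ind (x = x₀ n)).re * ((ind (C = C₀ n)).re * (S.prob n mpk ct C (BCirc.eval C x) sk *
          (1 / 2 * (1 - cloneProb 𝒜 n mpk ct (k n) (m n) sk)))) := by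
      rw [hprob]
      ring
    unfold FEScheme.simProb
    simp_rw [hterm, Finset.sum_add_distrib, ← Finset.mul_sum, sum_ind_re_mul]
    have h' : BCirc.eval (s := A.circSize n) (C₀ n) (x₀ n) =
      BCirc.eval (s := A.circSize n) (C₀ n) (x₁ n) := h
    simp_rw [h', ← Finset.sum_add_distrib]
    refine Eq.trans ?_ ((congrArg (1 / 2 * ·)
      (S.sum_prob n (C₀ n) (BCirc.eval (C₀ n) (x₁ n)))).trans (mul_one _))
    simp_rw [Finset.mul_sum]
    refine Finset.sum_congr rfl fun mpk _ => Finset.sum_congr rfl fun ct _ =>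
      Finset.sum_congr rfl fun sk _ => ?_
    ring
  -- If the two values differ, the bounded quantity is 0 by definition and nothing is claimed.
  split_ifs with h
  · rw [hreal, hsim h, abs_abs, ← abs_of_pos (zero_lt_two' ℝ), ← abs_mul,
      abs_of_pos (zero_lt_two' ℝ)]
    exact le_of_eq (congrArg abs (by ring))
  · simp

end Scheme

section Avg

variable {α β γ δ : Type} [Fintype α] [DecidableEq α] [Fintype β] [DecidableEq β] [Fintype γ]
  [DecidableEq γ] [Fintype δ] [DecidableEq δ]

theorem avg_rotate (f : Bits α → Bits β → Bits γ → Bits δ → ℝ) :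
    (avg fun a => avg fun b => avg fun c => avg fun d => f a b c d) =
      avg fun b => avg fun c => avg fun d => avg fun a => f a b c d :=
  (avg_comm fun a b => avg fun c => avg fun d => f a b c d).trans <|
    congrArg avg <| funext fun b => (avg_comm fun a c => avg fun d => f a b c d).trans <|
      congrArg avg <| funext fun c => avg_comm fun a d => f a b c d

theorem avg_le_of_forall_le {f : Bits α → ℝ} {B : ℝ} (h : ∀ x, f x ≤ B) : avg f ≤ B :=
  (avg_mono h).trans (avg_const B).le

end Avg

/-- In the application `i` is the indicator of correct decryption, so the last term is the failure
probability. -/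
theorem SKEScheme.expect_le {msgLen : ℕ → ℕ} (S : SKEScheme msgLen) (n : ℕ)
    (x : Bits (Fin (msgLen n))) {f g i : Bits (Fin (S.keyLen n)) → Bits (Fin (S.ctLen n)) → ℝ}
    {a : ℝ} (h : ∀ K c, f K c ≤ g K c + a + (1 - i K c)) :
    S.expect n x f ≤ S.expect n x g + a + (1 - S.expect n x i) := by
  unfold SKEScheme.expect
  refine (avg_mono fun r => avg_mono fun r' => h _ _).trans (le_of_eq ?_)
  simp_rw [avg_add, avg_sub, avg_const]

theorem UEScheme.keyProb_nonneg (UE : UEScheme) (n : ℕ) (k) : 0 ≤ UE.keyProb n k :=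
  (UE.setup n).prob_nonneg _ _

theorem UEScheme.sum_keyProb (UE : UEScheme) (n : ℕ) : ∑ k, UE.keyProb n k = 1 :=
  (UE.setup n).sum_prob _

/-- The winning probability is linear in the ciphertext state. -/
def winFunctional {P T Sk M MB MC : Type} [Fintype T] [DecidableEq T] [Fintype MB]
    [DecidableEq MB] [Fintype MC] [DecidableEq MC] (A : QCirc (P ⊕ T) (MB ⊕ MC))
    (B : QCirc (Sk ⊕ MB) M) (C : QCirc (Sk ⊕ MC) M) (pk : Bits P) (sk : Bits Sk) (m : Bits M) :
    Op T →ₗ[ℝ] ℝ where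
  toFun ρ := bothGuess B C sk m (A.applyWith pk ρ)
  map_add' ρ σ := by
    simp only [bothGuess, QCirc.applyWith, Matrix.of_apply, Matrix.add_apply, mul_add,
      Finset.sum_add_distrib, Complex.add_re]
  map_smul' c ρ := by
    simp only [bothGuess, QCirc.applyWith, Matrix.of_apply, Matrix.smul_apply, Complex.real_smul,
      mul_left_comm _ (c : ℂ), ← Finset.mul_sum, Complex.re_ofReal_mul, RingHom.id_apply,
      smul_eq_mul]

/-- The winning probability on a mixture is the average of the winning probabilities. -/
theorem bothGuess_mixture {P T Sk M MB MC ι ω : Type} [Fintype T] [DecidableEq T] [Fintype MB]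
    [DecidableEq MB] [Fintype MC] [DecidableEq MC] [Fintype ι] [Fintype ω] [DecidableEq ω]
    (A : QCirc (P ⊕ T) (MB ⊕ MC)) (B : QCirc (Sk ⊕ MB) M) (C : QCirc (Sk ⊕ MC) M) (pk : Bits P)
    (sk : Bits Sk) (m : Bits M) (p : ι → ℝ) (ρ : ι → Bits ω → Op T) :
    bothGuess B C sk m (A.applyWith pk (∑ k, ∑ r, (p k / 2 ^ Fintype.card ω) • ρ k r)) =
      ∑ k, p k * avg fun r => bothGuess B C sk m (A.applyWith pk (ρ k r)) := by
  refine (map_sum (winFunctional A B C pk sk m) _ _).trans (Finset.sum_congr rfl fun k _ => ?_)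
  rw [map_sum, avg, Finset.sum_div, Finset.mul_sum]
  refine Finset.sum_congr rfl fun r _ => ?_
  rw [map_smul, smul_eq_mul, div_mul_eq_mul_div, mul_div_assoc]
  rfl

/-- The ciphertext of the scheme is defined entrywise. This exhibits it as a mixture, over the
encryption coins, of states with a fixed classical part. -/
theorem mixture_tagged_apply {γ τ ω : Type} [Fintype ω] [DecidableEq ω] [Fintype γ]
    [DecidableEq γ] (p : ℝ) (c : Bits ω → Bits γ) (ρ : Op τ) (y y' : Bits (γ ⊕ τ)) :
    ((p * avg fun r => if y ∘ .inl = c r ∧ y' ∘ .inl = c r then 1 else 0 : ℝ) : ℂ) *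
        ρ (y ∘ .inr) (y' ∘ .inr) =
      (∑ r, (p / 2 ^ Fintype.card ω) • tagged (c r) ρ : Op (γ ⊕ τ)) y y' := by
  simp only [avg, Matrix.sum_apply, Matrix.smul_apply, tagged, Matrix.of_apply, Complex.real_smul]
  push_cast [apply_ite Complex.ofReal]
  simp only [ite_eq_ind, ind_and, Finset.sum_div, Finset.mul_sum, Finset.sum_mul]
  refine Finset.sum_congr rfl fun r _ => ?_
  ring

/-! ### The winning probability as an average, and the reduction to the private-key scheme -/

section Scheme

variable {UE : UEScheme} {SKE : SKEScheme UE.keyLen}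
  {FE : FEScheme (fun n => TrojanIn (SKE.keyLen n) (UE.keyLen n)) (fun n => Fin (UE.keyLen n))}

/-- The message `(1, ⊥, k)`. -/
abbrev openMsg {κ u : ℕ} (k : Bits (Fin u)) : Bits (TrojanIn κ u) :=
  Sum.elim (fun _ => true) (Sum.elim (fun _ => false) k)

/-- The message `(0, K, ⊥)`. -/
abbrev hiddenMsg {κ u : ℕ} (K : Bits (Fin κ)) : Bits (TrojanIn κ u) :=
  Sum.elim (fun _ => false) (Sum.elim K fun _ => false)

/-- The winning probability when `FE` encrypts `x` and gives out the key of `F[ct]`, for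
fixed coins. -/
def coinProb (𝒜 : PBKUEAdversary UE SKE FE) (n : ℕ) (k : Bits (Fin (UE.keyLen n)))
    (x : Bits (TrojanIn (SKE.keyLen n) (UE.keyLen n))) (ct : Bits (Fin (SKE.ctLen n)))
    (m : Bits (Fin (UE.msgLen n))) (r : Bits (Fin (FE.setupCoins n (pbkueSize UE SKE n))))
    (r₁ : Bits (Fin (FE.encCoins n (pbkueSize UE SKE n))))
    (r₂ : Bits (Fin (FE.keyGenCoins n (pbkueSize UE SKE n)))) : ℝ :=
  cloneProb 𝒜 n (FE.mpk n _ r) (FE.encrypt n _ (FE.mpk n _ r) x r₁) k m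
    (FE.funKey n _ (FE.msk n _ r) (trojan (SKE.dec n) ct) r₂)

/-- The ciphertext is a mixture over `k` and the encryption coins, and success is linear in it. The
averages are ordered for the hybrids: `k` and `m` outside, because they get hardwired, and `ct`
innermost, because it is replaced first. -/
theorem winProb_PBKUE (𝒜 : (PBKUE UE SKE FE).Adversary) (n : ℕ) :
    (PBKUE UE SKE FE).winProb 𝒜 n = ∑ k, UE.keyProb n k *
      avg fun m => avg fun r => avg fun r₁ => avg fun r₂ => avg fun ct =>
        coinProb (FE := FE) 𝒜 n k (openMsg k) ct m r r₁ r₂ := by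
  have henc (pk m) : (PBKUE UE SKE FE).enc n pk m = ∑ k, ∑ r₁,
      (UE.keyProb n k / 2 ^ Fintype.card (Fin (FE.encCoins n (pbkueSize UE SKE n)))) •
        tagged (FE.encrypt n (pbkueSize UE SKE n) pk (openMsg k) r₁) (UE.encState n k m) := by
    ext y y'
    refine Eq.trans ?_ (Matrix.sum_apply _ _ _ _).symm
    exact Finset.sum_congr rfl fun k _ => mixture_tagged_apply (UE.keyProb n k)
      (FE.encrypt n (pbkueSize UE SKE n) pk (openMsg k)) (UE.encState n k m) y y'
  have hlin (pk sk m) : bothGuess (𝒜.bob n) (𝒜.charlie n) sk m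
      ((𝒜.alice n).applyWith pk ((PBKUE UE SKE FE).enc n pk m)) =
      ∑ k, UE.keyProb n k * avg fun r₁ => cloneProb (FE := FE) 𝒜 n pk
        (FE.encrypt n (pbkueSize UE SKE n) pk (openMsg k) r₁) k m sk := by
    rw [henc]
    exact bothGuess_mixture (𝒜.alice n) (𝒜.bob n) (𝒜.charlie n) pk sk m (UE.keyProb n) _
  have hwin : (PBKUE UE SKE FE).winProb 𝒜 n = avg fun r => avg fun ct => avg fun r₂ =>
      avg fun m => ∑ k, UE.keyProb n k * avg fun r₁ =>
        coinProb (FE := FE) 𝒜 n k (openMsg k) ct m r r₁ r₂ := by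
    unfold PKUEScheme.winProb
    simp_rw [hlin]
    refine (avg_sumElim _).trans (congrArg avg (funext fun r => ?_))
    exact avg_sumElim _
  rw [hwin]
  simp_rw [avg_sum, avg_const_mul]
  refine Finset.sum_congr rfl fun k _ => congrArg _ ?_
  refine Eq.trans ?_ (avg_comm _)
  refine congrArg avg (funext fun r => ?_)
  refine (avg_rotate _).trans ((avg_comm _).trans ?_)
  exact congrArg avg (funext fun m => avg_comm _)

/-- The adversary against the private-key scheme with hardwired coins. -/
theorem exists_ueAdversary (𝒜 : PBKUEAdversary UE SKE FE)
    (K : ∀ n, Bits (Fin (SKE.keyLen n))) (r' : ∀ n, Bits (Fin (SKE.encCoins n)))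
    (r : ∀ n, Bits (Fin (FE.setupCoins n (pbkueSize UE SKE n))))
    (r₁ : ∀ n, Bits (Fin (FE.encCoins n (pbkueSize UE SKE n))))
    (r₂ : ∀ n, Bits (Fin (FE.keyGenCoins n (pbkueSize UE SKE n)))) :
    ∃ 𝒜' : UE.Adversary, ∀ n, UE.winProb 𝒜' n = ∑ k, UE.keyProb n k * avg fun m =>
      coinProb 𝒜 n k (hiddenMsg (K n)) (SKE.enc n (Sum.elim (K n) (Sum.elim k (r' n)))) m
        (r n) (r₁ n) (r₂ n) := by
  obtain ⟨hp, hc, -⟩ := FE_len_poly UE SKE FE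
  obtain ⟨N₁, hN₁, h₁⟩ := SKE.enc_computable
  obtain ⟨N₂, hN₂, h₂⟩ := trojanKey_computable UE SKE FE
  -- The plaintext `(0, K, ⊥)` does not involve `k`, so the classical part of the ciphertext is a
  -- constant for Alice.
  choose A hAs hA using fun n => exists_alice_withKey (𝒜.alice n) (FE.mpk n _ (r n))
    (FE.encrypt n _ (FE.mpk n _ (r n)) (hiddenMsg (K n)) (r₁ n))
  -- From `k` both parties compute the encryption of `k` under `K` and then the functional key, with
  -- the same fixed coins.
  choose B C hBs hCs hBC using fun n => exists_guess_withKey (𝒜.bob n) (𝒜.charlie n)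
    ((h₂ n (FE.msk n _ (r n)) (r₂ n)).comp (h₁ n (K n) (r' n)))
  refine ⟨{ memB := 𝒜.memB, memC := 𝒜.memC, alice := A, bob := B, charlie := C
            alice_qpt := ?_, bob_qpt := ?_, charlie_qpt := ?_ }, fun n => ?_⟩
  · refine (((PolyBounded.const 2).mul (hp.add hc)).add 𝒜.alice_qpt).mono fun n => ?_
    simpa only [Nat.card_fin] using hAs n
  · exact ((hN₁.add hN₂).add 𝒜.bob_qpt).mono hBs
  · exact ((hN₁.add hN₂).add 𝒜.charlie_qpt).mono hCs
  · simp only [UEScheme.winProb, hBC, hA]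
    rfl

end Scheme

/-! ### The three hybrid bounds, uniform in the hardwired data -/

section Scheme

variable {UE : UEScheme} {SKE : SKEScheme UE.keyLen}
  {FE : FEScheme (fun n => TrojanIn (SKE.keyLen n) (UE.keyLen n)) (fun n => Fin (UE.keyLen n))}

theorem switchProb_mem (𝒜 : PBKUEAdversary UE SKE FE) (n : ℕ) (k m x C) :
    0 ≤ switchProb UE SKE FE 𝒜 n k m x C ∧ switchProb UE SKE FE 𝒜 n k m x C ≤ 1 := by
  constructor
  · refine (avg_const (0 : ℝ)).ge.trans (avg_mono fun r => ?_)
    refine (avg_const (0 : ℝ)).ge.trans (avg_mono fun r₁ => ?_)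
    refine (avg_const (0 : ℝ)).ge.trans (avg_mono fun r₂ => ?_)
    exact (cloneProb_mem ..).1
  · exact avg_le_of_forall_le fun r => avg_le_of_forall_le fun r₁ => avg_le_of_forall_le fun r₂ =>
      (cloneProb_mem ..).2

/-- Replacing the uniform string by an encryption of the key costs a negligible amount. -/
theorem exists_pseudorandom_bound (hPR : SKE.PseudorandomCiphertexts)
    (𝒜 : PBKUEAdversary UE SKE FE) : ∃ δ : ℕ → ℝ, Negligible δ ∧ ∀ n k m,
      (avg fun r => avg fun r₁ => avg fun r₂ => avg fun ct =>
        coinProb 𝒜 n k (openMsg k) ct m r r₁ r₂) ≤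
      (SKE.expect n k fun _ ct =>
        switchProb UE SKE FE 𝒜 n k m (openMsg k) (trojan (SKE.dec n) ct)) + δ n := by
  let φ (n : ℕ) (z : Bits (Fin (UE.keyLen n)) × Bits (Fin (UE.msgLen n)) ×
      Bits (Fin (FE.setupCoins n (pbkueSize UE SKE n))) ×
      Bits (Fin (FE.encCoins n (pbkueSize UE SKE n))) ×
      Bits (Fin (FE.keyGenCoins n (pbkueSize UE SKE n)))) : ℝ :=
    |(SKE.expect n z.1 fun _ ct =>
        coinProb 𝒜 n z.1 (openMsg z.1) ct z.2.1 z.2.2.1 z.2.2.2.1 z.2.2.2.2) -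
      avg fun ct => coinProb 𝒜 n z.1 (openMsg z.1) ct z.2.1 z.2.2.1 z.2.2.2.1 z.2.2.2.2|
  -- For each `n` there are finitely many choices of key, message and coins. The distinguisher with
  -- the worst one hardwired bounds all of them by a single negligible function.
  choose z hz using fun n => Finite.exists_max (φ n)
  refine ⟨fun n => φ n (z n), negligible_pseudorandom hPR 𝒜 (fun n => (z n).1)
    (fun n => (z n).2.1) (fun n => FE.mpk n _ (z n).2.2.1)
    (fun n => FE.encrypt n _ (FE.mpk n _ (z n).2.2.1) (openMsg (z n).1) (z n).2.2.2.1)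
    (fun n => FE.msk n _ (z n).2.2.1) (fun n => (z n).2.2.2.2), fun n k m => ?_⟩
  have h (r r₁ r₂) : (avg fun ct => coinProb 𝒜 n k (openMsg k) ct m r r₁ r₂) ≤
      (SKE.expect n k fun _ ct => coinProb 𝒜 n k (openMsg k) ct m r r₁ r₂) + φ n (z n) := by
    have := (neg_le_abs _).trans (hz n (k, m, r, r₁, r₂))
    simp only at this
    linarith
  refine (avg_mono fun r => avg_mono fun r₁ => avg_mono fun r₂ => h r r₁ r₂).trans (le_of_eq ?_)
  simp_rw [avg_add, avg_const]
  unfold switchProb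
  rw [SKE.expect_avg]
  simp_rw [SKE.expect_avg]
  rfl

/-- Replacing the encrypted message by the key of the symmetric scheme costs a negligible
amount. -/
theorem exists_switch_bound (hSKE : SKE.Correct) (hFE : FE.Secure)
    (𝒜 : PBKUEAdversary UE SKE FE) : ∃ δ : ℕ → ℝ, Negligible δ ∧ ∀ n k m,
      (SKE.expect n k fun _ ct =>
        switchProb UE SKE FE 𝒜 n k m (openMsg k) (trojan (SKE.dec n) ct)) ≤
      (SKE.expect n k fun K ct =>
        switchProb UE SKE FE 𝒜 n k m (hiddenMsg K) (trojan (SKE.dec n) ct)) + δ n := by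
  classical
  obtain ⟨ε, hε, hcorr⟩ := hSKE
  -- The value 0 where the circuit separates the two plaintexts lets the maximum range over all
  -- tuples, including those to which security does not apply.
  let φ (n : ℕ) (z : Bits (Fin (UE.keyLen n)) × Bits (Fin (UE.msgLen n)) ×
      Bits (Fin (SKE.keyLen n)) × Bits (Fin (SKE.ctLen n))) : ℝ :=
    if (trojan (SKE.dec n) z.2.2.2).eval (hiddenMsg z.2.2.1) =
        (trojan (SKE.dec n) z.2.2.2).eval (openMsg z.1) then
      |switchProb UE SKE FE 𝒜 n z.1 z.2.1 (openMsg z.1) (trojan (SKE.dec n) z.2.2.2) -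
        switchProb UE SKE FE 𝒜 n z.1 z.2.1 (hiddenMsg z.2.2.1) (trojan (SKE.dec n) z.2.2.2)|
    else 0
  choose z hz using fun n => Finite.exists_max (φ n)
  have hneg : Negligible fun n => φ n (z n) := by
    convert negligible_switch hFE 𝒜 (fun n => (z n).1) (fun n => (z n).2.1)
      (fun n => hiddenMsg (z n).2.2.1) (fun n => openMsg (z n).1)
      (fun n => trojan (SKE.dec n) (z n).2.2.2)
  refine ⟨fun n => φ n (z n) + ε n, hneg.add hε, fun n k m => ?_⟩
  have hφ (K c) : φ n (k, m, K, c) ≤ φ n (z n) := hz n _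
  change _ ≤ _ + (φ n (z n) + ε n)
  generalize φ n (z n) = a at hφ ⊢
  refine (SKE.expect_le n k (a := a)
    (i := fun K c => if (SKE.dec n).eval (Sum.elim K c) = k then 1 else 0)
    (g := fun K c => switchProb UE SKE FE 𝒜 n k m (hiddenMsg K) (trojan (SKE.dec n) c))
    fun K c => ?_).trans ?_
  · have hb := hφ K c
    have h₁ := (switchProb_mem 𝒜 n k m (openMsg k) (trojan (SKE.dec n) c)).2
    have h₀ := (switchProb_mem 𝒜 n k m (hiddenMsg K) (trojan (SKE.dec n) c)).1
    -- The two values agree exactly when `c` decrypts to `k`. Otherwise the loss `1 - 0` suffices,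
    -- since both probabilities lie between 0 and 1.
    have he : (trojan (SKE.dec n) c).eval (hiddenMsg K) =
        (trojan (SKE.dec n) c).eval (openMsg k) ↔ (SKE.dec n).eval (Sum.elim K c) = k := by
      rw [trojan_eval, trojan_eval]
      simp
    simp only [φ, he] at hb
    split_ifs at hb ⊢ with hd
    · have := (le_abs_self _).trans hb
      linarith
    · linarith
  · have h : 1 - ε n ≤ SKE.expect n k fun K c =>
        if (SKE.dec n).eval (Sum.elim K c) = k then 1 else 0 := by
      convert hcorr n k
    linarith

/-- In the last hybrid the scheme is as secure as the private-key scheme. -/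
theorem exists_hidden_bound {t : ℕ → ℝ} (hsec : UE.UncloneableSecure t)
    (𝒜 : PBKUEAdversary UE SKE FE) : ∃ δ : ℕ → ℝ, Negligible δ ∧ ∀ n,
      ∑ k, UE.keyProb n k * (avg fun m => SKE.expect n k fun K ct =>
        switchProb UE SKE FE 𝒜 n k m (hiddenMsg K) (trojan (SKE.dec n) ct)) ≤
      (2 : ℝ) ^ (-(UE.msgLen n : ℝ) + t n) + δ n := by
  let φ (n : ℕ) (z : Bits (Fin (SKE.setupCoins n)) × Bits (Fin (SKE.encCoins n)) ×
      Bits (Fin (FE.setupCoins n (pbkueSize UE SKE n))) ×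
      Bits (Fin (FE.encCoins n (pbkueSize UE SKE n))) ×
      Bits (Fin (FE.keyGenCoins n (pbkueSize UE SKE n)))) : ℝ :=
    ∑ k, UE.keyProb n k * avg fun m =>
      coinProb 𝒜 n k (hiddenMsg (SKE.setup n z.1))
        (SKE.enc n (Sum.elim (SKE.setup n z.1) (Sum.elim k z.2.1))) m z.2.2.1 z.2.2.2.1 z.2.2.2.2
  -- Here `k` and `m` are not fixed, since the cloning game against `UE` samples them; only the
  -- coins are set to the values most favourable to the adversary, which is at least as good as
  -- their average.
  choose z hz using fun n => Finite.exists_max (φ n)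
  obtain ⟨𝒜', h𝒜'⟩ := exists_ueAdversary 𝒜 (fun n => SKE.setup n (z n).1) (fun n => (z n).2.1)
    (fun n => (z n).2.2.1) (fun n => (z n).2.2.2.1) (fun n => (z n).2.2.2.2)
  obtain ⟨ε, hε, hwin⟩ := hsec 𝒜'
  refine ⟨ε, hε, fun n => le_trans ?_ ((h𝒜' n).ge.trans (hwin n))⟩
  have h : ∑ k, UE.keyProb n k * (avg fun m => SKE.expect n k fun K ct =>
        switchProb UE SKE FE 𝒜 n k m (hiddenMsg K) (trojan (SKE.dec n) ct)) =
      avg fun s => avg fun s' => avg fun r => avg fun r₁ => avg fun r₂ =>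
        φ n (s, s', r, r₁, r₂) := by
    simp only [φ]
    simp_rw [avg_sum, avg_const_mul]
    refine Finset.sum_congr rfl fun k _ => congrArg _ ?_
    unfold SKEScheme.expect
    refine (avg_comm _).trans (congrArg avg (funext fun s => ?_))
    refine (avg_comm _).trans (congrArg avg (funext fun s' => ?_))
    exact avg_rotate _
  rw [h]
  exact avg_le_of_forall_le fun s => avg_le_of_forall_le fun s' => avg_le_of_forall_le fun r =>
    avg_le_of_forall_le fun r₁ => avg_le_of_forall_le fun r₂ => hz n _

end Scheme

end

theorem mainTheorem2 (UE : UEScheme) (SKE : SKEScheme UE.keyLen)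
    (FE : FEScheme (fun n => TrojanIn (SKE.keyLen n) (UE.keyLen n)) (fun n => Fin (UE.keyLen n)))
    (hUE : UE.Correct)
    (hSKE : SKE.Correct) (hPR : SKE.PseudorandomCiphertexts)
    (hFE : FE.Correct) (hFEs : FE.Secure)
    (t : ℕ → ℝ) (hsec : UE.UncloneableSecure t) :
    (PBKUE UE SKE FE).UncloneableSecure t := by
  intro 𝒜
  obtain ⟨δ₁, hδ₁, h₁⟩ := exists_pseudorandom_bound (FE := FE) hPR 𝒜
  obtain ⟨δ₂, hδ₂, h₂⟩ := exists_switch_bound (FE := FE) hSKE hFEs 𝒜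
  obtain ⟨δ₃, hδ₃, h₃⟩ := exists_hidden_bound (FE := FE) hsec 𝒜
  refine ⟨_, hδ₃.add (hδ₁.add hδ₂), fun n => ?_⟩
  rw [winProb_PBKUE]
  -- The first two hybrid steps hold for every `k`, so they survive averaging over the key
  -- distribution, whose total weight is 1.
  have h (k) : (avg fun m => avg fun r => avg fun r₁ => avg fun r₂ => avg fun ct =>
      coinProb (FE := FE) 𝒜 n k (openMsg k) ct m r r₁ r₂) ≤
      (avg fun m => SKE.expect n k fun K ct =>
        switchProb UE SKE FE 𝒜 n k m (hiddenMsg K) (trojan (SKE.dec n) ct)) + (δ₁ n + δ₂ n) := by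
    refine (avg_mono fun m => (h₁ n k m).trans
      (add_le_add_left (h₂ n k m) (δ₁ n))).trans (le_of_eq ?_)
    simp_rw [avg_add, avg_const]
    ring
  have hsum := Finset.sum_le_sum fun k (_ : k ∈ Finset.univ) =>
    mul_le_mul_of_nonneg_left (h k) (UE.keyProb_nonneg n k)
  simp_rw [mul_add (UE.keyProb n _), Finset.sum_add_distrib, ← Finset.sum_mul, UE.sum_keyProb,
    one_mul] at hsum
  refine hsum.trans ?_
  refine (add_le_add_left (h₃ n) _).trans (le_of_eq ?_)
  exact add_assoc _ _ _
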